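/- All groupoids are topological groupoids $G$ with object space $G^0$ that are étale (range and source maps $r,s\colon G\to G^0$ are local homeomorphisms). Call $G$ \emph{locally compact} if $G^0$ is Hausdorff and locally compact. A \emph{groupoid correspondence} $X\colon H\leftarrow G$ is a topological space $X$ with commuting continuous actions of $H$ on the left and $G$ on the right such that the right anchor map $s\colon X\to G^0$ is a local homeomorphism and the right action is basic, that is, $(x,g)\mapsto (x,x\cdot g)$ is a homeomorphism from $X\times_{s,G^0,r}G$ onto its image in $X\times X$. It is \emph{proper} if the map $X/G\to H^0$ induced by the left anchor map $r\colon X\to H^0$ is proper; it is \emph{locally compact} if $H$ and $G$ are locally compact and $X/G$ is Hausdorff. The composite $X\circ_G Y$ of $X\colon H\leftarrow G$ and $Y\colon G\leftarrow K$ is the orbit space of $X\times_{s,G^0,r}Y$ by the diagonal $G$-action, with the induced actions of $H$ and $K$. Let $\mathcal C$ be a small category. A \emph{$\mathcal C$-shaped diagram of groupoid correspondences} $F$ consists of groupoids $G_x$ for the objects $x$ of $\mathcal C$, correspondences $X_g\colon G_x\leftarrow G_y$ for the arrows $g\colon x\leftarrow y$, and isomorphisms of correspondences $\mu_{g,h}\colon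 X_g\circ_{G_y}X_h\cong X_{gh}$ for composable arrows $g\colon z\leftarrow y$, $h\colon y\leftarrow x$, such that $X_{1_x}$ is (identified with) the identity correspondence $G_x$, the maps $\mu_{g,1}$ and $\mu_{1,g}$ are the canonical isomorphisms, and the maps $\mu$ are associative. Write $\gamma_1\cdot\gamma_2=\mu_{g,h}[\gamma_1,\gamma_2]$. The diagram is \emph{proper} (\emph{locally compact}) if all the correspondences $X_g$ are proper (all $G_x$ and $X_g$ are locally compact). An \emph{$F$-action} on a topological space $Y$ consists of a partition $Y=\bigsqcup_x Y_x$ into clopen subsets indexed by the objects of $\mathcal C$, continuous maps $r\colon Y_x\to G_x^0$, and open, continuous, surjective maps $X_g\times_{s,G_x^0,r}Y_x\to Y_{x'}$, $(\gamma,y)\mapsto\gamma\cdot y$, for all arrows $g\colon x'\leftarrow x$, such that $r(\gamma\cdot y)=r(\gamma)$; $\gamma_1\cdot(\gamma_2\cdot y)=(\gamma_1\cdot\gamma_2)\cdot y$ whenever defined; and if $\gamma\cdot y=\gamma'\cdot y'$ for $\gamma,\gamma'\in X_g$ and $y,y'\in Y_x$, then there is $\eta\in G_x$ with $\gamma'=\gamma\cdot\eta$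 and $y=\eta\cdot y'$. A continuous map $\varphi\colon Y\to Z$ between spaces with $F$-actions is \emph{$F$-equivariant} if $\varphi(Y_x)\subseteq Z_x$ for all $x$, $r\circ\varphi=r$ and $\varphi(\gamma\cdot y)=\gamma\cdot\varphi(y)$. An $F$-action on $\Omega$ is \emph{universal} if every $F$-action admits a unique continuous $F$-equivariant map to it. A \emph{groupoid model} of $F$ is an étale groupoid $U$ with bijections between the $U$-actions and the $F$-actions on $Y$ for all topological spaces $Y$ that are natural, that is, a continuous map is $U$-equivariant if and only if it is $F$-equivariant for the corresponding actions. \textbf{Corollary.} Let $F$ be a diagram of proper, locally compact groupoid correspondences. Assume that $\mathcal C$ has only finitely many objects and that each object space $G_x^0$ is compact. Then a universal $F$-action exists, and every universal $F$-action lives on a compact Hausdorff space. A groupoid model of $F$ exists, and every groupoid model of $F$ is a locally compact groupoid with compact object space. -/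

import Mathlib

open CategoryTheory

universe u

namespace GroupoidDiagrams

/-! ### Étale groupoids and their actions -/

/-- An étale topological groupoid: a topological groupoid whose range and source maps are local
homeomorphisms. The product `mul g h` is defined if `s g = r h`. No separation or local
compactness is assumed of the object space or of the arrow space. -/
structure EtaleGroupoid : Type (u + 1) where
  Obj : Type u
  Arr : Type u
  [topObj : TopologicalSpace Obj]
  [topArr : TopologicalSpace Arr]
  r : Arr → Obj
  s : Arr → Obj
  unit : Obj → Arr
  inv : Arr → Arr
  mul : ∀ g h : Arr, s g = r h → Arr
  r_mul : ∀ (g h : Arr) (e : s g = r h), r (mul g h e) = r g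
  s_mul : ∀ (g h : Arr) (e : s g = r h), s (mul g h e) = s h
  mul_assoc : ∀ (g h k : Arr) (e : s g = r h) (e' : s h = r k),
    mul (mul g h e) k ((s_mul g h e).trans e') = mul g (mul h k e') (e.trans (r_mul h k e').symm)
  r_unit : ∀ x : Obj, r (unit x) = x
  s_unit : ∀ x : Obj, s (unit x) = x
  unit_mul : ∀ g : Arr, mul (unit (r g)) g (s_unit (r g)) = g
  mul_unit : ∀ g : Arr, mul g (unit (s g)) (r_unit (s g)).symm = g
  r_inv : ∀ g : Arr, r (inv g) = s g
  s_inv : ∀ g : Arr, s (inv g) = r g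
  mul_inv : ∀ g : Arr, mul g (inv g) (r_inv g).symm = unit (r g)
  inv_mul : ∀ g : Arr, mul (inv g) g (s_inv g) = unit (s g)
  continuous_unit : Continuous unit
  continuous_inv : Continuous inv
  continuous_mul : Continuous fun p : {p : Arr × Arr // s p.1 = r p.2} => mul p.1.1 p.1.2 p.2
  isLocalHomeomorph_r : IsLocalHomeomorph r
  isLocalHomeomorph_s : IsLocalHomeomorph s

attribute [instance] EtaleGroupoid.topObj EtaleGroupoid.topArr

/-- An étale groupoid is locally compact if its object space is Hausdorff and locally compact. -/
def EtaleGroupoid.IsLocallyCompact (G : EtaleGroupoid.{u}) : Prop :=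
  T2Space G.Obj ∧ LocallyCompactSpace G.Obj

/-- A (continuous) left action of an étale groupoid on a topological space. -/
structure LeftAction (G : EtaleGroupoid.{u}) (Y : Type u) [TopologicalSpace Y] : Type u where
  anchor : Y → G.Obj
  smul : ∀ (g : G.Arr) (y : Y), G.s g = anchor y → Y
  continuous_anchor : Continuous anchor
  continuous_smul :
    Continuous fun p : {p : G.Arr × Y // G.s p.1 = anchor p.2} => smul p.1.1 p.1.2 p.2
  anchor_smul : ∀ (g : G.Arr) (y : Y) (e : G.s g = anchor y), anchor (smul g y e) = G.r g
  mul_smul : ∀ (g h : G.Arr) (y : Y) (e : G.s g = G.r h) (e' : G.s h = anchor y),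
    smul (G.mul g h e) y ((G.s_mul g h e).trans e') =
      smul g (smul h y e') (e.trans (anchor_smul h y e').symm)
  unit_smul : ∀ y : Y, smul (G.unit (anchor y)) y (G.s_unit (anchor y)) = y

/-- A (continuous) right action of an étale groupoid on a topological space. -/
structure RightAction (G : EtaleGroupoid.{u}) (X : Type u) [TopologicalSpace X] : Type u where
  anchor : X → G.Obj
  smul : ∀ (x : X) (g : G.Arr), anchor x = G.r g → X
  continuous_anchor : Continuous anchor
  continuous_smul :
    Continuous fun p : {p : X × G.Arr // anchor p.1 = G.r p.2} => smul p.1.1 p.1.2 p.2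
  anchor_smul : ∀ (x : X) (g : G.Arr) (e : anchor x = G.r g), anchor (smul x g e) = G.s g
  smul_mul : ∀ (x : X) (g h : G.Arr) (e : anchor x = G.r g) (e' : G.s g = G.r h),
    smul x (G.mul g h e') (e.trans (G.r_mul g h e').symm) =
      smul (smul x g e) h ((anchor_smul x g e).trans e')
  smul_unit : ∀ x : X, smul x (G.unit (anchor x)) (G.r_unit (anchor x)).symm = x

namespace RightAction

variable {G : EtaleGroupoid.{u}} {X : Type u} [TopologicalSpace X]

/-- A right action is basic if the map `(x, g) ↦ (x, x · g)` from `X ×_{G⁰} G` to `X × X` is a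
homeomorphism onto its image (with the subspace topology). In particular, it is free. -/
def IsBasic (a : RightAction G X) : Prop :=
  Topology.IsEmbedding
    fun p : {p : X × G.Arr // a.anchor p.1 = G.r p.2} => (p.1.1, a.smul p.1.1 p.1.2 p.2)

/-- The orbit equivalence relation of a right action. -/
def orbitSetoid (a : RightAction G X) : Setoid X where
  r x x' := ∃ (g : G.Arr) (e : a.anchor x = G.r g), x' = a.smul x g e
  iseqv :=
    { refl := fun x => ⟨_, _, (a.smul_unit x).symm⟩
      symm := by
        rintro x _ ⟨g, e, rfl⟩
        refine ⟨G.inv g, (a.anchor_smul x g e).trans (G.r_inv g).symm, ?_⟩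
        rw [← a.smul_mul x g (G.inv g) e (G.r_inv g).symm]
        simp only [G.mul_inv]
        simp only [← e]
        exact (a.smul_unit x).symm
      trans := by
        rintro x _ _ ⟨g, e, rfl⟩ ⟨h, e', rfl⟩
        have e'' : G.s g = G.r h := (a.anchor_smul x g e).symm.trans e'
        exact ⟨G.mul g h e'', e.trans (G.r_mul g h e'').symm, (a.smul_mul x g h e e'').symm⟩ }

/-- The orbit space `X / G`, with the quotient topology. -/
abbrev OrbitSpace (a : RightAction G X) : Type u := Quotient a.orbitSetoid

end RightAction

/-- An equivariant map between left actions of an étale groupoid. -/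
def LeftAction.IsEquivariant {G : EtaleGroupoid.{u}} {Y Z : Type u} [TopologicalSpace Y]
    [TopologicalSpace Z] (a : LeftAction G Y) (b : LeftAction G Z) (φ : C(Y, Z)) : Prop :=
  ∃ h : ∀ y : Y, b.anchor (φ y) = a.anchor y,
    ∀ (g : G.Arr) (y : Y) (e : G.s g = a.anchor y),
      φ (a.smul g y e) = b.smul g (φ y) (e.trans (h y).symm)

/-! ### Groupoid correspondences -/

/-- An (étale) groupoid correspondence `H ← G`: a space with commuting actions of `H` on the left
and of `G` on the right, such that the right anchor map is a local homeomorphism and the right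
action is basic. -/
structure Correspondence (H G : EtaleGroupoid.{u}) : Type (u + 1) where
  carrier : Type u
  [top : TopologicalSpace carrier]
  left : LeftAction H carrier
  right : RightAction G carrier
  left_anchor_smul : ∀ (x : carrier) (g : G.Arr) (e : right.anchor x = G.r g),
    left.anchor (right.smul x g e) = left.anchor x
  right_anchor_smul : ∀ (h : H.Arr) (x : carrier) (e : H.s h = left.anchor x),
    right.anchor (left.smul h x e) = right.anchor x
  smul_comm : ∀ (h : H.Arr) (x : carrier) (g : G.Arr) (e : H.s h = left.anchor x)
    (e' : right.anchor x = G.r g),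
    right.smul (left.smul h x e) g ((right_anchor_smul h x e).trans e') =
      left.smul h (right.smul x g e') (e.trans (left_anchor_smul x g e').symm)
  isLocalHomeomorph_anchor : IsLocalHomeomorph right.anchor
  isBasic : right.IsBasic

attribute [instance] Correspondence.top

namespace Correspondence

variable {H G K : EtaleGroupoid.{u}}

/-- The left anchor map `r`. -/
abbrev r (X : Correspondence H G) : X.carrier → H.Obj := X.left.anchor

/-- The right anchor map `s`. -/
abbrev s (X : Correspondence H G) : X.carrier → G.Obj := X.right.anchor

/-- The map `X / G → H⁰` induced by the left anchor map. -/
def orbitAnchor (X : Correspondence H G) : X.right.OrbitSpace → H.Obj :=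
  Quotient.lift X.r (by
    rintro x _ ⟨g, e, rfl⟩
    exact (X.left_anchor_smul x g e).symm)

/-- A correspondence `X : H ← G` is proper if the induced map `X / G → H⁰` is proper. -/
def IsProper (X : Correspondence H G) : Prop := IsProperMap X.orbitAnchor

/-- A locally compact correspondence: both groupoids are locally compact and the orbit space
`X / G` is Hausdorff. -/
def IsLocallyCompact (X : Correspondence H G) : Prop :=
  H.IsLocallyCompact ∧ G.IsLocallyCompact ∧ T2Space X.right.OrbitSpace

/-- The identity correspondence `G ← G`: the arrow space with the two multiplication actions. -/
def id (G : EtaleGroupoid.{u}) : Correspondence G G where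
  carrier := G.Arr
  left :=
    { anchor := G.r
      smul := G.mul
      continuous_anchor := G.isLocalHomeomorph_r.continuous
      continuous_smul := G.continuous_mul
      anchor_smul := G.r_mul
      mul_smul := G.mul_assoc
      unit_smul := G.unit_mul }
  right :=
    { anchor := G.s
      smul := G.mul
      continuous_anchor := G.isLocalHomeomorph_s.continuous
      continuous_smul := G.continuous_mul
      anchor_smul := G.s_mul
      smul_mul := fun x g h e e' => (G.mul_assoc x g h e e').symm
      smul_unit := G.mul_unit }
  left_anchor_smul := G.r_mul
  right_anchor_smul := G.s_mul
  smul_comm := G.mul_assoc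
  isLocalHomeomorph_anchor := G.isLocalHomeomorph_s
  isBasic := by
    have hc : Continuous fun p : {p : G.Arr × G.Arr // G.s p.1 = G.r p.2} =>
        (p.1.1, G.mul p.1.1 p.1.2 p.2) :=
      (continuous_fst.comp continuous_subtype_val).prodMk G.continuous_mul
    -- the inverse map is `(g, k) ↦ (g, g⁻¹ k)`
    have hinv : ∀ (g h : G.Arr) (e : G.s g = G.r h)
        (e' : G.s (G.inv g) = G.r (G.mul g h e)), G.mul (G.inv g) (G.mul g h e) e' = h := by
      intro g h e e'
      rw [← G.mul_assoc (G.inv g) g h (G.s_inv g) e]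
      simp only [G.inv_mul]
      simp only [e]
      exact G.unit_mul h
    let D := {q : G.Arr × G.Arr // G.r q.1 = G.r q.2}
    let f : {p : G.Arr × G.Arr // G.s p.1 = G.r p.2} → D :=
      fun p => ⟨(p.1.1, G.mul p.1.1 p.1.2 p.2), (G.r_mul _ _ _).symm⟩
    let k : D → G.Arr × G.Arr :=
      fun q => (q.1.1, G.mul (G.inv q.1.1) q.1.2 ((G.s_inv _).trans q.2))
    have hk : Continuous k := by
      refine (continuous_fst.comp continuous_subtype_val).prodMk ?_
      exact G.continuous_mul.comp (Continuous.subtype_mk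
        (f := fun q : D => (G.inv q.1.1, q.1.2))
        ((G.continuous_inv.comp (continuous_fst.comp continuous_subtype_val)).prodMk
          (continuous_snd.comp continuous_subtype_val))
        (fun q => (G.s_inv _).trans q.2))
    have hf : Continuous f := hc.subtype_mk _
    have hkf : k ∘ f = Subtype.val := by
      funext p
      exact Prod.ext rfl (hinv _ _ _ _)
    have hfe : Topology.IsEmbedding f :=
      Topology.IsEmbedding.of_comp hf hk (hkf ▸ Topology.IsEmbedding.subtypeVal)
    exact Topology.IsEmbedding.subtypeVal.comp hfe

/-- An isomorphism of correspondences `H ← G`: a homeomorphism that is equivariant for both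
actions. -/
structure Iso (X Y : Correspondence H G) : Type u where
  toHomeomorph : X.carrier ≃ₜ Y.carrier
  r_apply : ∀ x, Y.r (toHomeomorph x) = X.r x
  s_apply : ∀ x, Y.s (toHomeomorph x) = X.s x
  map_left : ∀ (h : H.Arr) (x : X.carrier) (e : H.s h = X.r x),
    toHomeomorph (X.left.smul h x e) = Y.left.smul h (toHomeomorph x) (e.trans (r_apply x).symm)
  map_right : ∀ (x : X.carrier) (g : G.Arr) (e : X.s x = G.r g),
    toHomeomorph (X.right.smul x g e) = Y.right.smul (toHomeomorph x) g ((s_apply x).trans e)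

/-- The fibre product `X ×_{G⁰} Y`. -/
abbrev FibreProd (X : Correspondence H G) (Y : Correspondence G K) : Type u :=
  {p : X.carrier × Y.carrier // X.s p.1 = Y.r p.2}

/-- The equivalence relation on `X ×_{G⁰} Y` generated by the diagonal `G`-action
`(x, y) · g = (x · g, g⁻¹ · y)`: the pairs `(x, g · y)` and `(x · g, y)` are identified. -/
def compSetoid (X : Correspondence H G) (Y : Correspondence G K) : Setoid (X.FibreProd Y) where
  r p q := ∃ (g : G.Arr) (e : X.s p.1.1 = G.r g) (e' : G.s g = Y.r q.1.2),
    q.1.1 = X.right.smul p.1.1 g e ∧ p.1.2 = Y.left.smul g q.1.2 e'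
  iseqv :=
    { refl := by
        rintro ⟨⟨x, y⟩, exy⟩
        simp only at exy
        refine ⟨G.unit (X.s x), (G.r_unit _).symm, (G.s_unit _).trans exy,
          (X.right.smul_unit x).symm, ?_⟩
        simp only [exy]
        exact (Y.left.unit_smul y).symm
      symm := by
        rintro ⟨⟨x, y⟩, exy⟩ ⟨⟨x', y'⟩, exy'⟩ ⟨g, e, e', h1, h2⟩
        simp only at exy exy' e e' h1 h2
        subst h1 h2
        refine ⟨G.inv g, (X.right.anchor_smul x g e).trans (G.r_inv g).symm,
          (G.s_inv g).trans (Y.left.anchor_smul g y' e').symm, ?_, ?_⟩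
        · simp only
          rw [← X.right.smul_mul x g (G.inv g) e (G.r_inv g).symm]
          simp only [G.mul_inv]
          simp only [← e]
          exact (X.right.smul_unit x).symm
        · simp only
          rw [← Y.left.mul_smul (G.inv g) g y' (G.s_inv g) e']
          simp only [G.inv_mul]
          simp only [e']
          exact (Y.left.unit_smul y').symm
      trans := by
        rintro ⟨⟨x, y⟩, exy⟩ ⟨⟨x', y'⟩, exy'⟩ ⟨⟨x'', y''⟩, exy''⟩ ⟨g, e, e', h1, h2⟩
          ⟨k, d, d', j1, j2⟩
        simp only at exy exy' exy'' e e' h1 h2 d d' j1 j2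
        subst h1 h2 j1 j2
        have c : G.s g = G.r k := (X.right.anchor_smul x g e).symm.trans d
        exact ⟨G.mul g k c, e.trans (G.r_mul g k c).symm, (G.s_mul g k c).trans d',
          (X.right.smul_mul x g k e c).symm, (Y.left.mul_smul g k y'' c d').symm⟩ }

/-- The underlying space of the composite correspondence `X ∘_G Y : H ← K`: the orbit space of
`X ×_{G⁰} Y` by the diagonal `G`-action, with the quotient topology. -/
abbrev CompSpace (X : Correspondence H G) (Y : Correspondence G K) : Type u :=
  Quotient (X.compSetoid Y)

/-- The class `[x, y]` in the composite correspondence. -/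
def compMk (X : Correspondence H G) (Y : Correspondence G K) (x : X.carrier) (y : Y.carrier)
    (e : X.s x = Y.r y) : X.CompSpace Y :=
  Quotient.mk (X.compSetoid Y) ⟨(x, y), e⟩

/-- An isomorphism of correspondences `X ∘_G Y ≅ Z`: a homeomorphism that is equivariant for the
left `H`-action and the right `K`-action. The anchor maps and actions on the composite are
`r [x, y] = r x`, `s [x, y] = s y`, `h · [x, y] = [h · x, y]`, `[x, y] · k = [x, y · k]`. -/
structure CompIso (X : Correspondence H G) (Y : Correspondence G K) (Z : Correspondence H K) :
    Type u where
  toHomeomorph : X.CompSpace Y ≃ₜ Z.carrier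
  r_apply : ∀ (x : X.carrier) (y : Y.carrier) (e : X.s x = Y.r y),
    Z.r (toHomeomorph (X.compMk Y x y e)) = X.r x
  s_apply : ∀ (x : X.carrier) (y : Y.carrier) (e : X.s x = Y.r y),
    Z.s (toHomeomorph (X.compMk Y x y e)) = Y.s y
  map_left : ∀ (h : H.Arr) (x : X.carrier) (y : Y.carrier) (e : X.s x = Y.r y)
    (d : H.s h = X.r x),
    toHomeomorph (X.compMk Y (X.left.smul h x d) y ((X.right_anchor_smul h x d).trans e)) =
      Z.left.smul h (toHomeomorph (X.compMk Y x y e)) (d.trans (r_apply x y e).symm)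
  map_right : ∀ (x : X.carrier) (y : Y.carrier) (k : K.Arr) (e : X.s x = Y.r y)
    (d : Y.s y = K.r k),
    toHomeomorph (X.compMk Y x (Y.right.smul y k d) (e.trans (Y.left_anchor_smul y k d).symm)) =
      Z.right.smul (toHomeomorph (X.compMk Y x y e)) k ((s_apply x y e).trans d)

/-- The product `x · y := μ [x, y]` of elements with `s x = r y`. -/
def CompIso.app {X : Correspondence H G} {Y : Correspondence G K} {Z : Correspondence H K}
    (μ : CompIso X Y Z) (x : X.carrier) (y : Y.carrier) (e : X.s x = Y.r y) : Z.carrier :=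
  μ.toHomeomorph (X.compMk Y x y e)

end Correspondence

/-! ### Diagrams of groupoid correspondences -/

/-- A `C`-shaped diagram of groupoid correspondences, that is, a bicategory homomorphism from the
category `C` to the bicategory of groupoid correspondences.

An arrow `g : y ⟶ x` of `C` gives a correspondence `X g : G x ← G y`. For composable arrows
`g : y ⟶ z` and `h : x ⟶ y`, there is an isomorphism `μ : X g ∘ X h ≅ X (h ≫ g)`; the index `k`
with `h ≫ g = k` only serves to state associativity without transport along equalities of arrows.
The unit isomorphism `ι x` identifies `X (𝟙 x)` with the identity correspondence on `G x`. -/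
structure Diagram (C : Type u) [SmallCategory C] : Type (u + 1) where
  G : C → EtaleGroupoid.{u}
  X : ∀ {x y : C}, (y ⟶ x) → Correspondence (G x) (G y)
  ι : ∀ x : C, (Correspondence.id (G x)).Iso (X (𝟙 x))
  μ : ∀ {x y z : C} (g : y ⟶ z) (h : x ⟶ y) (k : x ⟶ z), h ≫ g = k →
    Correspondence.CompIso (X g) (X h) (X k)
  μ_unit_right : ∀ {x y : C} (g : y ⟶ x) (γ : (X g).carrier) (η : (G y).Arr)
    (e : (X g).s γ = (G y).r η),
    (μ g (𝟙 y) g (Category.id_comp g)).app γ ((ι y).toHomeomorph η)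
      (e.trans ((ι y).r_apply η).symm) = (X g).right.smul γ η e
  μ_unit_left : ∀ {x y : C} (g : y ⟶ x) (η : (G x).Arr) (γ : (X g).carrier)
    (e : (G x).s η = (X g).r γ),
    (μ (𝟙 x) g g (Category.comp_id g)).app ((ι x).toHomeomorph η) γ
      (((ι x).s_apply η).trans e) = (X g).left.smul η γ e
  μ_assoc : ∀ {x₀ x₁ x₂ x₃ : C} (g₀₁ : x₁ ⟶ x₀) (g₁₂ : x₂ ⟶ x₁) (g₂₃ : x₃ ⟶ x₂)
    (g₀₂ : x₂ ⟶ x₀) (g₁₃ : x₃ ⟶ x₁) (g₀₃ : x₃ ⟶ x₀)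
    (h₀₂ : g₁₂ ≫ g₀₁ = g₀₂) (h₁₃ : g₂₃ ≫ g₁₂ = g₁₃)
    (h : g₂₃ ≫ g₀₂ = g₀₃) (h' : g₁₃ ≫ g₀₁ = g₀₃)
    (a : (X g₀₁).carrier) (b : (X g₁₂).carrier) (c : (X g₂₃).carrier)
    (e : (X g₀₁).s a = (X g₁₂).r b) (e' : (X g₁₂).s b = (X g₂₃).r c),
    (μ g₀₂ g₂₃ g₀₃ h).app ((μ g₀₁ g₁₂ g₀₂ h₀₂).app a b e) c
        (((μ g₀₁ g₁₂ g₀₂ h₀₂).s_apply a b e).trans e') =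
      (μ g₀₁ g₁₃ g₀₃ h').app a ((μ g₁₂ g₂₃ g₁₃ h₁₃).app b c e')
        (e.trans ((μ g₁₂ g₂₃ g₁₃ h₁₃).r_apply b c e').symm)

namespace Diagram

variable {C : Type u} [SmallCategory C]

/-- A diagram is proper if all its correspondences are proper. -/
def IsProper (F : Diagram C) : Prop := ∀ {x y : C} (g : y ⟶ x), (F.X g).IsProper

/-- A diagram is locally compact if all its groupoids and correspondences are locally compact. -/
def IsLocallyCompact (F : Diagram C) : Prop :=
  (∀ x : C, (F.G x).IsLocallyCompact) ∧ ∀ {x y : C} (g : y ⟶ x), (F.X g).IsLocallyCompact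

/-- An action of the diagram `F` on a topological space `Y`. -/
structure Action (F : Diagram C) (Y : Type u) [TopologicalSpace Y] : Type u where
  /-- The clopen subsets `Y_x` of the partition (some of which may be empty). -/
  part : C → Set Y
  isClopen_part : ∀ x, IsClopen (part x)
  existsUnique_part : ∀ y : Y, ∃! x, y ∈ part x
  /-- The anchor maps `r : Y_x → G_x⁰`. -/
  anchor : ∀ x : C, part x → (F.G x).Obj
  continuous_anchor : ∀ x, Continuous (anchor x)
  /-- The maps `α_g : X_g ×_{G_x⁰} Y_x → Y_{x'}` for arrows `g : x ⟶ x'`. -/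
  act : ∀ {x x' : C} (g : x ⟶ x') (γ : (F.X g).carrier) (y : part x),
    (F.X g).s γ = anchor x y → part x'
  continuous_act : ∀ {x x' : C} (g : x ⟶ x'),
    Continuous fun p : {p : (F.X g).carrier × part x // (F.X g).s p.1 = anchor x p.2} =>
      act g p.1.1 p.1.2 p.2
  isOpenMap_act : ∀ {x x' : C} (g : x ⟶ x'),
    IsOpenMap fun p : {p : (F.X g).carrier × part x // (F.X g).s p.1 = anchor x p.2} =>
      act g p.1.1 p.1.2 p.2
  surjective_act : ∀ {x x' : C} (g : x ⟶ x'),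
    Function.Surjective
      fun p : {p : (F.X g).carrier × part x // (F.X g).s p.1 = anchor x p.2} =>
        act g p.1.1 p.1.2 p.2
  anchor_act : ∀ {x x' : C} (g : x ⟶ x') (γ : (F.X g).carrier) (y : part x)
    (e : (F.X g).s γ = anchor x y), anchor x' (act g γ y e) = (F.X g).r γ
  act_act : ∀ {x x' x'' : C} (g₁ : x' ⟶ x'') (g₂ : x ⟶ x') (γ₁ : (F.X g₁).carrier)
    (γ₂ : (F.X g₂).carrier) (y : part x) (e₁ : (F.X g₁).s γ₁ = (F.X g₂).r γ₂)
    (e₂ : (F.X g₂).s γ₂ = anchor x y),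
    act g₁ γ₁ (act g₂ γ₂ y e₂) (e₁.trans (anchor_act g₂ γ₂ y e₂).symm) =
      act (g₂ ≫ g₁) ((F.μ g₁ g₂ (g₂ ≫ g₁) rfl).app γ₁ γ₂ e₁) y
        (((F.μ g₁ g₂ (g₂ ≫ g₁) rfl).s_apply γ₁ γ₂ e₁).trans e₂)
  /-- If `γ · y = γ' · y'`, then `γ' = γ · η` and `y = η · y'` for some arrow `η` of `G_x`, which
  acts on `Y_x` through the identification of `G_x` with the correspondence of `𝟙 x`. -/
  exists_of_act_eq : ∀ {x x' : C} (g : x ⟶ x') (γ γ' : (F.X g).carrier) (y y' : part x)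
    (e : (F.X g).s γ = anchor x y) (e' : (F.X g).s γ' = anchor x y'),
    act g γ y e = act g γ' y' e' →
      ∃ (η : (F.G x).Arr) (d : (F.X g).s γ = (F.G x).r η) (d' : (F.G x).s η = anchor x y'),
        γ' = (F.X g).right.smul γ η d ∧
          y = act (𝟙 x) ((F.ι x).toHomeomorph η) y' (((F.ι x).s_apply η).trans d')

/-- A continuous map is `F`-equivariant if it preserves the partitions, the anchor maps and the
multiplication maps. -/
def Action.IsEquivariant {F : Diagram C} {Y Z : Type u} [TopologicalSpace Y] [TopologicalSpace Z]
    (a : F.Action Y) (b : F.Action Z) (φ : C(Y, Z)) : Prop :=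
  ∃ (hp : ∀ (x : C) (y : a.part x), φ y ∈ b.part x)
    (hr : ∀ (x : C) (y : a.part x), b.anchor x ⟨φ y, hp x y⟩ = a.anchor x y),
    ∀ {x x' : C} (g : x ⟶ x') (γ : (F.X g).carrier) (y : a.part x)
      (e : (F.X g).s γ = a.anchor x y),
      φ (a.act g γ y e) = b.act g γ ⟨φ y, hp x y⟩ (e.trans (hr x y).symm)

/-- An `F`-action on `Ω` is universal if every `F`-action admits a unique continuous
`F`-equivariant map to it. -/
def Action.IsUniversal {F : Diagram C} {Ω : Type u} [TopologicalSpace Ω] (a : F.Action Ω) : Prop :=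
  ∀ (Y : Type u) [TopologicalSpace Y] (b : F.Action Y), ∃! φ : C(Y, Ω), b.IsEquivariant a φ

/-- An étale groupoid `U` is a groupoid model of `F` if there are bijections between the
`U`-actions and the `F`-actions on each space `Y` that are natural: a continuous map is
`U`-equivariant if and only if it is `F`-equivariant for the corresponding actions. -/
def IsGroupoidModel (F : Diagram C) (U : EtaleGroupoid.{u}) : Prop :=
  ∃ E : ∀ (Y : Type u) [TopologicalSpace Y], LeftAction U Y ≃ F.Action Y,
    ∀ (Y Z : Type u) [TopologicalSpace Y] [TopologicalSpace Z] (a : LeftAction U Y)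
      (b : LeftAction U Z) (φ : C(Y, Z)),
      a.IsEquivariant b φ ↔ (E Y a).IsEquivariant (E Z b) φ

end Diagram

end GroupoidDiagrams

namespace GroupoidDiagrams

open Set Filter Topology

/-! ### Topological preliminaries -/

section Topology

variable {A B D : Type*} [TopologicalSpace A] [TopologicalSpace B] [TopologicalSpace D]

/-! The universal action is a space of invariants of points. A point of `Y_x` in an `F`-action has
an anchor in `G_x⁰`, a class in `X_g / G` for each arrow `g` into `x`, and the values of a family of
`[0,1]`-valued functions that are defined on all actions by the same formal expressions (`Term`) and
are preserved by equivariant maps. Properness and compactness of the object spaces make the orbit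
spaces compact, and local compactness makes them Hausdorff. So all these invariants live in one
compact Hausdorff product, and they form a set although the actions range over a whole universe. The
fibre `Ω_x` is the closure of this set.

Elements of `X_g` act locally through slices as partial homeomorphisms, and expressions may be
transported along a slice or its inverse after multiplication by a bump function supported in the
domain. Hence `γ` and the invariants of `y` determine those of `γ · y`, and conversely. This
survives limits: the closure of the graph of the multiplication is still single-valued in both
directions (`actRel_right_unique`, `actRel_left_unique`). Compactness supplies existence of products
(`exists_actRel_right`, `exists_actRel_left`), the closed graph theorem gives continuity and
openness, and density of genuine points gives associativity. So `Ω` is an `F`-action. The functions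
evaluated on `Ω` are its own coordinates (`univAction_eval_mk`), which forces uniqueness of
equivariant maps to `Ω`. With finitely many objects `Ω` is compact Hausdorff, and universal actions
are unique up to homeomorphism.

A groupoid model is the groupoid of germs, over a universal action, of words in slices and their
inverses. Two words have the same germ at `ω` if they agree near `ω` on every action over `Ω`, not
just on `Ω` itself, which need not detect how words act elsewhere. With this definition germs act on
every `F`-action. Conversely, an action of the germ groupoid becomes an `F`-action by pulling back
the partition and the anchors along its anchor map and letting elements of `X_g` act through their
germs. Finally, the object space of any groupoid model is terminal among its actions and so carries
a universal `F`-action, to which compactness and the Hausdorff property transfer. -/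

theorem isOpenMap_fibreProd_fst {f : A → B} {g : D → B} (hf : Continuous f) (hg : IsOpenMap g) :
    IsOpenMap fun p : {p : A × D // f p.1 = g p.2} => p.1.1 := by
  intro U hU
  obtain ⟨W, hW, rfl⟩ := isOpen_induced_iff.1 hU
  rw [isOpen_iff_mem_nhds]
  rintro _ ⟨⟨⟨a, d⟩, h⟩, hm, rfl⟩
  obtain ⟨A₀, D₀, hA₀, hD₀, ha, hd, hs⟩ := isOpen_prod_iff.1 hW a d hm
  refine mem_of_superset ((hA₀.inter ((hg D₀ hD₀).preimage hf)).mem_nhds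
    ⟨ha, ⟨d, hd, h.symm⟩⟩) ?_
  rintro a' ⟨ha', d', hd', h'⟩
  exact ⟨⟨(a', d'), h'.symm⟩, hs (mk_mem_prod ha' hd'), rfl⟩

theorem isOpenMap_fibreProd_snd {f : A → B} {g : D → B} (hf : IsOpenMap f) (hg : Continuous g) :
    IsOpenMap fun p : {p : A × D // f p.1 = g p.2} => p.1.2 := by
  intro U hU
  obtain ⟨W, hW, rfl⟩ := isOpen_induced_iff.1 hU
  rw [isOpen_iff_mem_nhds]
  rintro _ ⟨⟨⟨a, d⟩, h⟩, hm, rfl⟩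
  obtain ⟨A₀, D₀, hA₀, hD₀, ha, hd, hs⟩ := isOpen_prod_iff.1 hW a d hm
  refine mem_of_superset ((hD₀.inter ((hf A₀ hA₀).preimage hg)).mem_nhds
    ⟨hd, ⟨a, ha, h⟩⟩) ?_
  rintro d' ⟨hd', a', ha', h'⟩
  exact ⟨⟨(a', d'), h'⟩, hs (mk_mem_prod ha' hd'), rfl⟩

/-- A lift of a continuous map through an open map is continuous if it takes values in an open set
on which the open map is injective. -/
theorem continuous_of_comp_of_injOn {f : A → B} (hf : IsOpenMap f) {V : Set A} (hV : IsOpen V)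
    (hi : InjOn f V) {c : D → A} (hc : ∀ d, c d ∈ V) (hfc : Continuous fun d => f (c d)) :
    Continuous c := by
  refine continuous_def.2 fun O hO => ?_
  have : c ⁻¹' O = (fun d => f (c d)) ⁻¹' (f '' (V ∩ O)) := by
    ext d
    refine ⟨fun h => ⟨c d, ⟨hc d, h⟩, rfl⟩, ?_⟩
    rintro ⟨x, ⟨hxV, hxO⟩, hx⟩
    rw [mem_preimage, ← hi hxV (hc d) hx]
    exact hxO
  rw [this]
  exact (hf _ (hV.inter hO)).preimage hfc

/-- The closed graph theorem for maps to a compact space. -/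
theorem continuous_of_isClosed_graph_of_compactSpace [CompactSpace B] {R : Set (A × B)}
    (hR : IsClosed R) {f : A → B} (hf : ∀ a b, (a, b) ∈ R ↔ b = f a) : Continuous f := by
  refine continuous_iff_isClosed.2 fun S hS => ?_
  have : f ⁻¹' S = Prod.fst '' (R ∩ Prod.snd ⁻¹' S) := by
    ext a
    constructor
    · exact fun h => ⟨(a, f a), ⟨(hf _ _).2 rfl, h⟩, rfl⟩
    · rintro ⟨⟨a', b⟩, ⟨h, hb⟩, rfl⟩
      rw [mem_preimage, ← (hf _ _).1 h]
      exact hb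
  rw [this]
  exact isClosedMap_fst_of_compactSpace _ (hR.inter (hS.preimage continuous_snd))

theorem _root_.IsLocalHomeomorph.exists_isOpen_injOn {f : A → B} (hf : IsLocalHomeomorph f)
    (a : A) :
    ∃ V : Set A, IsOpen V ∧ a ∈ V ∧ InjOn f V := by
  obtain ⟨e, he, rfl⟩ := hf a
  exact ⟨e.source, e.open_source, he, e.injOn⟩

end Topology

/-! ### Orbit spaces of basic actions -/

namespace EtaleGroupoid

/-- The units form an open subset of an étale groupoid. -/
theorem exists_isOpen_eq_unit (G : EtaleGroupoid.{u}) (x : G.Obj) :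
    ∃ W : Set G.Arr, IsOpen W ∧ G.unit x ∈ W ∧ ∀ g ∈ W, g = G.unit (G.r g) := by
  obtain ⟨W, hW, hx, hi⟩ := G.isLocalHomeomorph_r.exists_isOpen_injOn (G.unit x)
  -- For `g` in this set, `g` and the unit at `r g` lie in `W` and have the same range, so
  -- injectivity of `r` on `W` makes them equal.
  refine ⟨W ∩ (fun g => G.unit (G.r g)) ⁻¹' W, hW.inter (hW.preimage
    (G.continuous_unit.comp G.isLocalHomeomorph_r.continuous)), ⟨hx, ?_⟩, ?_⟩
  · simpa only [mem_preimage, G.r_unit] using hx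
  · rintro g ⟨hg, hg'⟩
    exact hi hg hg' (G.r_unit _).symm

end EtaleGroupoid

namespace RightAction

variable {G : EtaleGroupoid.{u}} {X : Type u} [TopologicalSpace X] (a : RightAction G X)

/-- The orbit map. -/
def orbitMk (x : X) : a.OrbitSpace := Quotient.mk _ x

theorem continuous_orbitMk : Continuous a.orbitMk := continuous_quotient_mk'

theorem orbitMk_surjective : Function.Surjective a.orbitMk := Quotient.mk_surjective

variable {a} in
theorem orbitMk_eq_iff {x x' : X} :
    a.orbitMk x = a.orbitMk x' ↔ ∃ (g : G.Arr) (e : a.anchor x = G.r g), x' = a.smul x g e :=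
  Quotient.eq (r := a.orbitSetoid)

theorem orbitMk_smul (x : X) (g : G.Arr) (e : a.anchor x = G.r g) :
    a.orbitMk (a.smul x g e) = a.orbitMk x :=
  (orbitMk_eq_iff.2 ⟨g, e, rfl⟩).symm

/-- The saturation of `V` is the projection to `X` of the preimage of `V` under the action map, and
this projection is open because `r` is open on arrows. -/
theorem isOpenMap_orbitMk : IsOpenMap a.orbitMk := by
  intro V hV
  refine (isQuotientMap_quotient_mk' (s := a.orbitSetoid)).isOpen_preimage.1 ?_
  change IsOpen (Quotient.mk a.orbitSetoid ⁻¹' (a.orbitMk '' V))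
  have : (Quotient.mk a.orbitSetoid) ⁻¹' (a.orbitMk '' V) =
      (fun p : {p : X × G.Arr // a.anchor p.1 = G.r p.2} => p.1.1) ''
        ((fun p : {p : X × G.Arr // a.anchor p.1 = G.r p.2} => a.smul p.1.1 p.1.2 p.2) ⁻¹' V) := by
    ext x
    constructor
    · rintro ⟨v, hv, h⟩
      obtain ⟨g, e, rfl⟩ := orbitMk_eq_iff.1 (show a.orbitMk x = a.orbitMk v from h.symm)
      exact ⟨⟨(x, g), e⟩, hv, rfl⟩
    · rintro ⟨⟨⟨x, g⟩, e⟩, hv, rfl⟩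
      exact ⟨_, hv, a.orbitMk_smul x g e⟩
  rw [this]
  exact isOpenMap_fibreProd_fst a.continuous_anchor G.isLocalHomeomorph_r.isOpenMap _
    (hV.preimage a.continuous_smul)

variable {a}

theorem IsBasic.eq_of_smul_eq (h : a.IsBasic) {x : X} {g g' : G.Arr} {e : a.anchor x = G.r g}
    {e' : a.anchor x = G.r g'} (hg : a.smul x g e = a.smul x g' e') : g = g' := by
  have := h.injective (a₁ := ⟨(x, g), e⟩) (a₂ := ⟨(x, g'), e'⟩) (Prod.ext rfl hg)
  exact congrArg (fun p => p.1.2) this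

/-- The orbit map of a basic action is locally injective. -/
theorem IsBasic.exists_isOpen_injOn (h : a.IsBasic) (x : X) :
    ∃ V : Set X, IsOpen V ∧ x ∈ V ∧ InjOn a.orbitMk V := by
  obtain ⟨W, hW, hx, hu⟩ := G.exists_isOpen_eq_unit (a.anchor x)
  -- The embedding from basicness detects closeness of the arrow to a unit by closeness of `(x, x ·
  -- g)` to the diagonal. On a small enough neighbourhood of `x`, orbit-equivalent points are
  -- therefore related by a unit.
  obtain ⟨N, hN, hNW⟩ := h.isInducing.isOpen_iff.1
    (hW.preimage (continuous_snd.comp continuous_subtype_val))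
  have hxN : (x, x) ∈ N := by
    have : (⟨(x, G.unit (a.anchor x)), (G.r_unit _).symm⟩ :
        {p : X × G.Arr // a.anchor p.1 = G.r p.2}) ∈ (fun p =>
          (p.1.1, a.smul p.1.1 p.1.2 p.2)) ⁻¹' N := by
      rw [hNW]
      exact hx
    simpa only [mem_preimage, a.smul_unit] using this
  obtain ⟨V₁, V₂, hV₁, hV₂, h₁, h₂, hs⟩ := isOpen_prod_iff.1 hN x x hxN
  refine ⟨V₁ ∩ V₂, hV₁.inter hV₂, ⟨h₁, h₂⟩, ?_⟩
  rintro y hy y' hy' hyy'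
  obtain ⟨g, e, rfl⟩ := orbitMk_eq_iff.1 hyy'
  have hg : (⟨(y, g), e⟩ : {p : X × G.Arr // a.anchor p.1 = G.r p.2}) ∈
      (fun p => (p.1.1, a.smul p.1.1 p.1.2 p.2)) ⁻¹' N := hs (mk_mem_prod hy.1 hy'.2)
  rw [hNW] at hg
  have hg' := hu g hg
  have : g = G.unit (a.anchor y) := by rw [e]; exact hg'
  subst this
  exact (a.smul_unit y).symm

end RightAction

/-! ### Slices -/

namespace Diagram

variable {C : Type u} [SmallCategory C] {F : Diagram C}

/-- A slice of a diagram: an open subset of one of the correspondences on which the right anchor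
map and the orbit map are injective. -/
structure Slice (F : Diagram C) : Type u where
  {src tgt : C}
  hom : src ⟶ tgt
  carrier : Set (F.X hom).carrier
  isOpen : IsOpen carrier
  injOn_s : InjOn (F.X hom).s carrier
  injOn_orbitMk : InjOn (F.X hom).right.orbitMk carrier

theorem isOpenMap_s {x y : C} (g : x ⟶ y) : IsOpenMap (F.X g).s :=
  (F.X g).isLocalHomeomorph_anchor.isOpenMap

theorem continuous_s {x y : C} (g : x ⟶ y) : Continuous (F.X g).s :=
  (F.X g).isLocalHomeomorph_anchor.continuous

theorem exists_slice {x y : C} (g : x ⟶ y) (γ : (F.X g).carrier) {N : Set (F.X g).carrier}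
    (hN : IsOpen N) (hγ : γ ∈ N) :
    ∃ V : Set (F.X g).carrier, IsOpen V ∧ V ⊆ N ∧ γ ∈ V ∧ InjOn (F.X g).s V ∧
      InjOn (F.X g).right.orbitMk V := by
  obtain ⟨V₁, ho₁, h₁, hi₁⟩ := (F.X g).isLocalHomeomorph_anchor.exists_isOpen_injOn γ
  obtain ⟨V₂, ho₂, h₂, hi₂⟩ := (F.X g).isBasic.exists_isOpen_injOn γ
  refine ⟨N ∩ (V₁ ∩ V₂), hN.inter (ho₁.inter ho₂), inter_subset_left, ⟨hγ, h₁, h₂⟩,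
    hi₁.mono fun z hz => hz.2.1, hi₂.mono fun z hz => hz.2.2⟩

/-- The multiplication `γ₁ · γ₂` in a diagram. -/
def mul (F : Diagram C) {x y z : C} (g : y ⟶ z) (h : x ⟶ y) (k : x ⟶ z) (hk : h ≫ g = k)
    (γ₁ : (F.X g).carrier) (γ₂ : (F.X h).carrier) (e : (F.X g).s γ₁ = (F.X h).r γ₂) :
    (F.X k).carrier := (F.μ g h k hk).app γ₁ γ₂ e

theorem s_mul {x y z : C} (g : y ⟶ z) (h : x ⟶ y) (k : x ⟶ z) (hk : h ≫ g = k)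
    (γ₁ : (F.X g).carrier) (γ₂ : (F.X h).carrier) (e : (F.X g).s γ₁ = (F.X h).r γ₂) :
    (F.X k).s (F.mul g h k hk γ₁ γ₂ e) = (F.X h).s γ₂ := (F.μ g h k hk).s_apply γ₁ γ₂ e

theorem continuous_mul {x y z : C} (g : y ⟶ z) (h : x ⟶ y) (k : x ⟶ z) (hk : h ≫ g = k) :
    Continuous fun p : (F.X g).FibreProd (F.X h) => F.mul g h k hk p.1.1 p.1.2 p.2 :=
  (F.μ g h k hk).toHomeomorph.continuous.comp continuous_quotient_mk'

/-! ### Cancellation, orbit maps and partial homeomorphisms for an action of a diagram. -/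

namespace Action

variable {Y : Type u} [TopologicalSpace Y] (b : F.Action Y)

theorem act_act' {x x' x'' : C} (g₁ : x' ⟶ x'') (g₂ : x ⟶ x') (k : x ⟶ x'') (hk : g₂ ≫ g₁ = k)
    (γ₁ : (F.X g₁).carrier) (γ₂ : (F.X g₂).carrier) (y : b.part x)
    (e₁ : (F.X g₁).s γ₁ = (F.X g₂).r γ₂) (e₂ : (F.X g₂).s γ₂ = b.anchor x y) :
    b.act g₁ γ₁ (b.act g₂ γ₂ y e₂) (e₁.trans (b.anchor_act g₂ γ₂ y e₂).symm) =
      b.act k (F.mul g₁ g₂ k hk γ₁ γ₂ e₁) y ((s_mul g₁ g₂ k hk γ₁ γ₂ e₁).trans e₂) := by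
  subst hk
  exact b.act_act g₁ g₂ γ₁ γ₂ y e₁ e₂

theorem act_congr {x x' : C} (g : x ⟶ x') {γ γ' : (F.X g).carrier} {y y' : b.part x}
    (hγ : γ = γ') (hy : y = y') (e : (F.X g).s γ = b.anchor x y)
    (e' : (F.X g).s γ' = b.anchor x y') : b.act g γ y e = b.act g γ' y' e' := by
  subst hγ hy; rfl

/-- Units act trivially. -/
theorem act_unit {x : C} (η : (F.G x).Arr) (y : b.part x) (hη : η = (F.G x).unit (b.anchor x y))
    (e : (F.X (𝟙 x)).s ((F.ι x).toHomeomorph η) = b.anchor x y) :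
    b.act (𝟙 x) ((F.ι x).toHomeomorph η) y e = y := by
  -- Triviality of units is not an axiom of `F`-actions. It follows from surjectivity for `𝟙 x`:
  -- writing the point as `γ · z` moves the unit onto `γ`, where it acts trivially.
  obtain ⟨⟨⟨γ, z⟩, hz⟩, h⟩ := b.surjective_act (𝟙 x) y
  simp only at hz h
  subst h
  rw [b.anchor_act] at hη
  have e₁ : (F.X (𝟙 x)).s ((F.ι x).toHomeomorph η) = (F.X (𝟙 x)).r γ :=
    e.trans (b.anchor_act _ _ _ _)
  rw [b.act_act' (𝟙 x) (𝟙 x) (𝟙 x) (Category.comp_id _) _ _ _ e₁ hz]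
  refine b.act_congr _ ?_ rfl _ _
  subst hη
  exact (F.μ_unit_left (𝟙 x) _ γ ((F.G x).s_unit _)).trans ((F.X (𝟙 x)).left.unit_smul γ)

/-- The two points differ by an arrow `η` with `γ = γ · η`; freeness of the right action makes `η` a
unit. -/
theorem act_injective {x x' : C} (g : x ⟶ x') (γ : (F.X g).carrier) (y y' : b.part x)
    (e : (F.X g).s γ = b.anchor x y) (e' : (F.X g).s γ = b.anchor x y')
    (h : b.act g γ y e = b.act g γ y' e') : y = y' := by
  obtain ⟨η, d, d', h₁, h₂⟩ := b.exists_of_act_eq g γ γ y y' e e' h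
  rw [h₂]
  refine b.act_unit η y' ?_ _
  rw [← e']
  exact (F.X g).isBasic.eq_of_smul_eq (e := d) (e' := ((F.G x).r_unit _).symm)
    (h₁.symm.trans ((F.X g).right.smul_unit γ).symm)

/-- The map `Y_{x'} → X_g / G_x`, `γ · y ↦ [γ]`. -/
noncomputable def orb {x x' : C} (g : x ⟶ x') (y : b.part x') : (F.X g).right.OrbitSpace :=
  (F.X g).right.orbitMk (b.surjective_act g y).choose.1.1

theorem orbitMk_eq_of_act_eq {x x' : C} (g : x ⟶ x') (γ γ' : (F.X g).carrier) (y y' : b.part x)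
    (e : (F.X g).s γ = b.anchor x y) (e' : (F.X g).s γ' = b.anchor x y')
    (h : b.act g γ y e = b.act g γ' y' e') :
    (F.X g).right.orbitMk γ = (F.X g).right.orbitMk γ' := by
  obtain ⟨η, d, d', h₁, h₂⟩ := b.exists_of_act_eq g γ γ' y y' e e' h
  rw [h₁, RightAction.orbitMk_smul]

theorem orb_act {x x' : C} (g : x ⟶ x') (γ : (F.X g).carrier) (y : b.part x)
    (e : (F.X g).s γ = b.anchor x y) : b.orb g (b.act g γ y e) = (F.X g).right.orbitMk γ :=
  b.orbitMk_eq_of_act_eq g _ _ _ _ (b.surjective_act g (b.act g γ y e)).choose.2 e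
    (b.surjective_act g (b.act g γ y e)).choose_spec

/-- The action map is an open continuous surjection, hence a quotient map, and upstairs the orbit
class is just that of `γ`. -/
theorem continuous_orb {x x' : C} (g : x ⟶ x') : Continuous (b.orb g) := by
  rw [((b.isOpenMap_act g).isQuotientMap (b.continuous_act g) (b.surjective_act g)).continuous_iff]
  have : (b.orb g ∘ fun p : {p : (F.X g).carrier × b.part x // (F.X g).s p.1 = b.anchor x p.2} =>
      b.act g p.1.1 p.1.2 p.2) = fun p => (F.X g).right.orbitMk p.1.1 :=
    funext fun p => b.orb_act g _ _ p.2
  rw [this]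
  exact ((F.X g).right.continuous_orbitMk).comp (continuous_fst.comp continuous_subtype_val)

/-- Every point over `[γ]` is of the form `γ · y`. -/
theorem exists_act_eq_of_orb_eq {x x' : C} (g : x ⟶ x') (γ : (F.X g).carrier) (y' : b.part x')
    (h : b.orb g y' = (F.X g).right.orbitMk γ) :
    ∃ (y : b.part x) (e : (F.X g).s γ = b.anchor x y), b.act g γ y e = y' := by
  obtain ⟨⟨⟨γ', y⟩, e⟩, rfl⟩ := b.surjective_act g y'
  rw [b.orb_act] at h
  obtain ⟨η, d, hη⟩ := RightAction.orbitMk_eq_iff.1 h.symm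
  simp only at hη e
  subst hη
  have e₁ : (F.G x).s η = b.anchor x y := ((F.X g).right.anchor_smul γ η d).symm.trans e
  refine ⟨b.act (𝟙 x) ((F.ι x).toHomeomorph η) y (((F.ι x).s_apply η).trans e₁),
    (d.trans ((F.ι x).r_apply η).symm).trans (b.anchor_act _ _ _ _).symm, ?_⟩
  rw [b.act_act' g (𝟙 x) g (Category.id_comp g) γ _ y (d.trans ((F.ι x).r_apply η).symm)]
  exact b.act_congr g (F.μ_unit_right g γ η d) rfl _ _

/-! ### The partial homeomorphisms given by slices -/

/-- The relation `y' = γ · y` for some `γ` in the slice `V`. -/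
def SliceRel (V : F.Slice) (y y' : Y) : Prop :=
  ∃ (hy : y ∈ b.part V.src) (γ : (F.X V.hom).carrier) (_ : γ ∈ V.carrier)
    (e : (F.X V.hom).s γ = b.anchor _ ⟨y, hy⟩), (b.act V.hom γ ⟨y, hy⟩ e : Y) = y'

variable {b} in
theorem SliceRel.right_unique {V : F.Slice} {y y₁ y₂ : Y} (h₁ : b.SliceRel V y y₁)
    (h₂ : b.SliceRel V y y₂) : y₁ = y₂ := by
  obtain ⟨hy, γ, hγ, e, rfl⟩ := h₁
  obtain ⟨_, γ', hγ', e', rfl⟩ := h₂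
  obtain rfl := V.injOn_s hγ hγ' (e.trans e'.symm)
  rfl

variable {b} in
theorem SliceRel.left_unique {V : F.Slice} {y₁ y₂ y' : Y} (h₁ : b.SliceRel V y₁ y')
    (h₂ : b.SliceRel V y₂ y') : y₁ = y₂ := by
  obtain ⟨hy, γ, hγ, e, rfl⟩ := h₁
  obtain ⟨hy', γ', hγ', e', h⟩ := h₂
  obtain rfl := V.injOn_orbitMk hγ' hγ (b.orbitMk_eq_of_act_eq _ _ _ _ _ _ _ (Subtype.ext h))
  exact congrArg Subtype.val (b.act_injective _ _ _ _ e e' (Subtype.ext h.symm))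

open Classical in
/-- The partial bijection given by a slice, extended by the identity. -/
noncomputable def sliceEquiv (V : F.Slice) : PartialEquiv Y Y where
  toFun y := if h : ∃ y', b.SliceRel V y y' then h.choose else y
  invFun y' := if h : ∃ y, b.SliceRel V y y' then h.choose else y'
  source := {y | ∃ y', b.SliceRel V y y'}
  target := {y' | ∃ y, b.SliceRel V y y'}
  map_source' := by
    rintro y (hy : ∃ y', b.SliceRel V y y')
    rw [dif_pos hy]
    exact ⟨y, Exists.choose_spec hy⟩
  map_target' := by
    rintro y (hy : ∃ z, b.SliceRel V z y)
    rw [dif_pos hy]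
    exact ⟨y, Exists.choose_spec hy⟩
  left_inv' := by
    rintro y (hy : ∃ y', b.SliceRel V y y')
    rw [dif_pos hy, dif_pos ⟨y, Exists.choose_spec hy⟩]
    exact (Exists.choose_spec (⟨y, Exists.choose_spec hy⟩ :
      ∃ z, b.SliceRel V z (Exists.choose hy))).left_unique (Exists.choose_spec hy)
  right_inv' := by
    rintro y (hy : ∃ z, b.SliceRel V z y)
    rw [dif_pos hy, dif_pos ⟨y, Exists.choose_spec hy⟩]
    exact (Exists.choose_spec (⟨y, Exists.choose_spec hy⟩ :
      ∃ z, b.SliceRel V (Exists.choose hy) z)).right_unique (Exists.choose_spec hy)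

variable {b} in
theorem SliceRel.sliceEquiv_eq {V : F.Slice} {y y' : Y} (h : b.SliceRel V y y') :
    b.sliceEquiv V y = y' := by
  have h' : ∃ y', b.SliceRel V y y' := ⟨y', h⟩
  have : b.sliceEquiv V y = h'.choose := dif_pos h'
  rw [this]
  exact h'.choose_spec.right_unique h

theorem mem_sliceEquiv_source {V : F.Slice} {y : Y} : y ∈ (b.sliceEquiv V).source ↔
    ∃ hy : y ∈ b.part V.src, b.anchor _ ⟨y, hy⟩ ∈ (F.X V.hom).s '' V.carrier := by
  constructor
  · rintro ⟨_, hy, γ, hγ, e, rfl⟩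
    exact ⟨hy, γ, hγ, e⟩
  · rintro ⟨hy, γ, hγ, e⟩
    exact ⟨_, hy, γ, hγ, e, rfl⟩

theorem mem_sliceEquiv_target {V : F.Slice} {y : Y} : y ∈ (b.sliceEquiv V).target ↔
    ∃ hy : y ∈ b.part V.tgt, b.orb V.hom ⟨y, hy⟩ ∈ (F.X V.hom).right.orbitMk '' V.carrier := by
  constructor
  · rintro ⟨y₀, hy, γ, hγ, e, rfl⟩
    exact ⟨(b.act V.hom γ ⟨y₀, hy⟩ e).2, γ, hγ, (b.orb_act _ _ _ e).symm⟩
  · rintro ⟨hy, γ, hγ, e⟩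
    obtain ⟨y₀, e₀, h⟩ := b.exists_act_eq_of_orb_eq _ γ _ e.symm
    exact ⟨y₀, y₀.2, γ, hγ, e₀, congrArg Subtype.val h⟩

theorem isOpen_subtype {x : C} {S : Set (b.part x)} (hS : IsOpen S) :
    IsOpen {y | ∃ hy : y ∈ b.part x, (⟨y, hy⟩ : b.part x) ∈ S} := by
  have := (b.isClopen_part x).isOpen.isOpenMap_subtype_val S hS
  convert this using 1
  ext y
  simp

theorem isOpen_sliceEquiv_source (V : F.Slice) : IsOpen (b.sliceEquiv V).source := by
  have := b.isOpen_subtype ((isOpenMap_s V.hom _ V.isOpen).preimage (b.continuous_anchor V.src))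
  convert this using 1
  ext y
  exact b.mem_sliceEquiv_source

theorem isOpen_sliceEquiv_target (V : F.Slice) : IsOpen (b.sliceEquiv V).target := by
  have := b.isOpen_subtype (((F.X V.hom).right.isOpenMap_orbitMk _ V.isOpen).preimage
    (b.continuous_orb V.hom))
  convert this using 1
  ext y
  exact b.mem_sliceEquiv_target

theorem continuousOn_sliceEquiv (V : F.Slice) :
    ContinuousOn (b.sliceEquiv V) (b.sliceEquiv V).source := by
  rw [continuousOn_iff_continuous_domRestrict]
  choose hy γ hγ e using fun y : (b.sliceEquiv V).source => b.mem_sliceEquiv_source.1 y.2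
  have hsub : Continuous fun y : (b.sliceEquiv V).source => (⟨y, hy y⟩ : b.part V.src) :=
    continuous_subtype_val.subtype_mk _
  -- The chosen `γ` is a lift of the anchor map through `s`, which is open and injective on the
  -- slice; this leaves no freedom in the choice.
  have hc : Continuous γ := by
    refine continuous_of_comp_of_injOn (isOpenMap_s V.hom) V.isOpen V.injOn_s hγ ?_
    simp only [e]
    exact (b.continuous_anchor _).comp hsub
  have : Continuous fun y : (b.sliceEquiv V).source => (b.act V.hom (γ y) ⟨y, hy y⟩ (e y) : Y) :=
    continuous_subtype_val.comp ((b.continuous_act V.hom).comp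
      ((hc.prodMk hsub).subtype_mk e))
  convert this using 1
  funext y
  exact SliceRel.sliceEquiv_eq ⟨hy y, γ y, hγ y, e y, rfl⟩

theorem isOpenMap_sliceEquiv (V : F.Slice) :
    IsOpenMap ((b.sliceEquiv V).source.domRestrict (b.sliceEquiv V)) := by
  intro U hU
  obtain ⟨W, hW, rfl⟩ := isOpen_induced_iff.1 hU
  have : (b.sliceEquiv V).source.domRestrict (b.sliceEquiv V) '' (Subtype.val ⁻¹' W) =
      (fun p : {p : (F.X V.hom).carrier × b.part V.src // (F.X V.hom).s p.1 = b.anchor _ p.2} =>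
        (b.act V.hom p.1.1 p.1.2 p.2 : Y)) '' {p | p.1.1 ∈ V.carrier ∧ (p.1.2 : Y) ∈ W} := by
    ext y
    constructor
    · rintro ⟨⟨y, _, hy, γ, hγ, e, rfl⟩, hW, rfl⟩
      exact ⟨⟨(γ, ⟨y, hy⟩), e⟩, ⟨hγ, hW⟩,
        (SliceRel.sliceEquiv_eq ⟨hy, γ, hγ, e, rfl⟩).symm⟩
    · rintro ⟨⟨⟨γ, y⟩, e⟩, ⟨hγ, hy⟩, rfl⟩
      exact ⟨⟨y, _, y.2, γ, hγ, e, rfl⟩, hy, SliceRel.sliceEquiv_eq ⟨y.2, γ, hγ, e, rfl⟩⟩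
  rw [this]
  refine ((b.isClopen_part _).isOpen.isOpenMap_subtype_val.comp (b.isOpenMap_act V.hom)) _ ?_
  exact (V.isOpen.preimage (continuous_fst.comp continuous_subtype_val)).inter
    (hW.preimage (continuous_subtype_val.comp (continuous_snd.comp continuous_subtype_val)))

/-- The partial homeomorphism given by a slice, extended by the identity. -/
noncomputable def slice (V : F.Slice) : OpenPartialHomeomorph Y Y where
  toPartialEquiv := b.sliceEquiv V
  open_source := b.isOpen_sliceEquiv_source V
  open_target := b.isOpen_sliceEquiv_target V
  continuousOn_toFun := b.continuousOn_sliceEquiv V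
  continuousOn_invFun := (b.sliceEquiv V).image_source_eq_target ▸
    (b.isOpenMap_sliceEquiv V).continuousOn_image_of_leftInvOn (b.sliceEquiv V).leftInvOn

theorem mem_slice_source {V : F.Slice} {y : Y} : y ∈ (b.slice V).source ↔
    ∃ hy : y ∈ b.part V.src, b.anchor _ ⟨y, hy⟩ ∈ (F.X V.hom).s '' V.carrier :=
  b.mem_sliceEquiv_source

theorem mem_slice_target {V : F.Slice} {y : Y} : y ∈ (b.slice V).target ↔
    ∃ hy : y ∈ b.part V.tgt, b.orb V.hom ⟨y, hy⟩ ∈ (F.X V.hom).right.orbitMk '' V.carrier :=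
  b.mem_sliceEquiv_target

theorem slice_apply (V : F.Slice) {γ : (F.X V.hom).carrier} (hγ : γ ∈ V.carrier) (y : b.part V.src)
    (e : (F.X V.hom).s γ = b.anchor _ y) : b.slice V y = b.act V.hom γ y e :=
  SliceRel.sliceEquiv_eq (b := b) ⟨y.2, γ, hγ, e, rfl⟩

theorem mem_slice_source_of_eq (V : F.Slice) {γ : (F.X V.hom).carrier} (hγ : γ ∈ V.carrier)
    (y : b.part V.src) (e : (F.X V.hom).s γ = b.anchor _ y) : (y : Y) ∈ (b.slice V).source :=
  b.mem_slice_source.2 ⟨y.2, γ, hγ, e⟩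

theorem slice_symm_apply (V : F.Slice) {γ : (F.X V.hom).carrier} (hγ : γ ∈ V.carrier)
    (y : b.part V.src) (e : (F.X V.hom).s γ = b.anchor _ y) :
    (b.slice V).symm (b.act V.hom γ y e) = y := by
  rw [← b.slice_apply V hγ y e]
  exact (b.slice V).left_inv (b.mem_slice_source_of_eq V hγ y e)

theorem slice_of_notMem {V : F.Slice} {y : Y} (h : y ∉ (b.slice V).source) : b.slice V y = y :=
  dif_neg h

theorem slice_symm_of_notMem {V : F.Slice} {y : Y} (h : y ∉ (b.slice V).target) :
    (b.slice V).symm y = y :=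
  dif_neg h

/-! ### Equivariant maps -/

variable {b}
variable {Z : Type u} [TopologicalSpace Z] {c : F.Action Z} {φ : C(Y, Z)}

theorem eq_of_mem_part {x x' : C} {y : Y} (h : y ∈ b.part x) (h' : y ∈ b.part x') : x = x' :=
  (b.existsUnique_part y).unique h h'

/-- The parts of the target are disjoint and those of the source cover, so a map preserving the
parts also reflects them. -/
theorem IsEquivariant.mem_part (h : b.IsEquivariant c φ) {x : C} {y : Y} :
    φ y ∈ c.part x ↔ y ∈ b.part x := by
  obtain ⟨hp, -⟩ := h
  refine ⟨fun hy => ?_, fun hy => hp x ⟨y, hy⟩⟩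
  obtain ⟨x', hx', -⟩ := b.existsUnique_part y
  obtain rfl := eq_of_mem_part hy (hp x' ⟨y, hx'⟩)
  exact hx'

theorem IsEquivariant.anchor_eq (h : b.IsEquivariant c φ) {x : C} {y : Y} (hy : y ∈ b.part x) :
    c.anchor x ⟨φ y, h.mem_part.2 hy⟩ = b.anchor x ⟨y, hy⟩ := by
  obtain ⟨hp, hr, -⟩ := h
  exact hr x ⟨y, hy⟩

theorem IsEquivariant.act_eq (h : b.IsEquivariant c φ) {x x' : C} (g : x ⟶ x')
    (γ : (F.X g).carrier) (y : b.part x) (e : (F.X g).s γ = b.anchor x y) :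
    φ (b.act g γ y e) = c.act g γ ⟨φ y, h.mem_part.2 y.2⟩ (e.trans (h.anchor_eq y.2).symm) := by
  obtain ⟨hp, hr, ha⟩ := h
  exact ha g γ y e

theorem IsEquivariant.orb_eq (h : b.IsEquivariant c φ) {x x' : C} (g : x ⟶ x') {y : Y}
    (hy : y ∈ b.part x') : c.orb g ⟨φ y, h.mem_part.2 hy⟩ = b.orb g ⟨y, hy⟩ := by
  obtain ⟨⟨⟨γ, z⟩, e⟩, hz⟩ := b.surjective_act g ⟨y, hy⟩
  rw [← hz, b.orb_act]
  have : (⟨φ y, h.mem_part.2 hy⟩ : c.part x') =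
      c.act g γ ⟨φ z, h.mem_part.2 z.2⟩ (e.trans (h.anchor_eq z.2).symm) := by
    refine Subtype.ext ?_
    rw [← h.act_eq g γ z e]
    exact congrArg φ (congrArg Subtype.val hz.symm)
  rw [this, c.orb_act]

theorem IsEquivariant.mem_slice_source (h : b.IsEquivariant c φ) {V : F.Slice} {y : Y} :
    φ y ∈ (c.slice V).source ↔ y ∈ (b.slice V).source := by
  rw [c.mem_slice_source, b.mem_slice_source]
  constructor
  · rintro ⟨hy, h'⟩
    exact ⟨h.mem_part.1 hy, by rwa [← h.anchor_eq]⟩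
  · rintro ⟨hy, h'⟩
    exact ⟨h.mem_part.2 hy, by rwa [h.anchor_eq]⟩

theorem IsEquivariant.mem_slice_target (h : b.IsEquivariant c φ) {V : F.Slice} {y : Y} :
    φ y ∈ (c.slice V).target ↔ y ∈ (b.slice V).target := by
  rw [c.mem_slice_target, b.mem_slice_target]
  constructor
  · rintro ⟨hy, h'⟩
    exact ⟨h.mem_part.1 hy, by rwa [← h.orb_eq]⟩
  · rintro ⟨hy, h'⟩
    exact ⟨h.mem_part.2 hy, by rwa [h.orb_eq]⟩

/-- Equivariant maps preserve and reflect the domain of a slice. Since slices are extended by the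
identity, naturality then holds at every point and not only on the domain. -/
theorem IsEquivariant.slice_eq (h : b.IsEquivariant c φ) (V : F.Slice) (y : Y) :
    φ (b.slice V y) = c.slice V (φ y) := by
  by_cases hy : y ∈ (b.slice V).source
  · obtain ⟨hy', γ, hγ, e⟩ := b.mem_slice_source.1 hy
    rw [b.slice_apply V hγ ⟨y, hy'⟩ e, h.act_eq, ← c.slice_apply V hγ]
  · rw [b.slice_of_notMem hy, c.slice_of_notMem (mt h.mem_slice_source.1 hy)]

theorem IsEquivariant.slice_symm_eq (h : b.IsEquivariant c φ) (V : F.Slice) (y : Y) :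
    φ ((b.slice V).symm y) = (c.slice V).symm (φ y) := by
  by_cases hy : y ∈ (b.slice V).target
  · have hy' := (b.slice V).map_target hy
    rw [← (c.slice V).left_inv (h.mem_slice_source.2 hy'), ← h.slice_eq,
      (b.slice V).right_inv hy]
  · rw [b.slice_symm_of_notMem hy, c.slice_symm_of_notMem (mt h.mem_slice_target.1 hy)]

theorem IsEquivariant.refl (b : F.Action Y) : b.IsEquivariant b (ContinuousMap.id Y) :=
  ⟨fun _ y => y.2, fun _ _ => rfl, fun _ _ _ _ => rfl⟩

theorem IsEquivariant.comp {W : Type u} [TopologicalSpace W] {d : F.Action W} {ψ : C(Z, W)}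
    (hψ : c.IsEquivariant d ψ) (hφ : b.IsEquivariant c φ) : b.IsEquivariant d (ψ.comp φ) :=
  ⟨fun _ y => hψ.mem_part.2 (hφ.mem_part.2 y.2),
    fun _ y => (hψ.anchor_eq (hφ.mem_part.2 y.2)).trans (hφ.anchor_eq y.2),
    fun g γ y e => by
      rw [ContinuousMap.comp_apply, hφ.act_eq, hψ.act_eq]
      rfl⟩

end Action

end Diagram

end GroupoidDiagrams

namespace GroupoidDiagrams

open Set Filter Topology

/-! ### Natural functions on actions of a diagram -/

section UnitInterval

/-- Bump functions with values in the unit interval. -/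
theorem exists_continuousMap_unitInterval {B : Type*} [TopologicalSpace B] [CompactSpace B]
    [T2Space B] {O : Set B} (hO : IsOpen O) {z : B} (hz : z ∈ O) :
    ∃ f : C(B, unitInterval), (∀ w ∉ O, f w = 0) ∧ f z = 1 := by
  obtain ⟨f, h₀, h₁, h⟩ := exists_continuous_zero_one_of_isClosed hO.isClosed_compl
    (isClosed_singleton (x := z)) (disjoint_singleton_right.2 fun h => h hz)
  refine ⟨⟨fun w => ⟨f w, h w⟩, f.continuous.subtype_mk _⟩, fun w hw => Subtype.ext (h₀ hw),
    Subtype.ext (h₁ rfl)⟩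

theorem eq_of_forall_continuousMap_unitInterval {B : Type*} [TopologicalSpace B] [CompactSpace B]
    [T2Space B] {z w : B} (h : ∀ f : C(B, unitInterval), f z = f w) : z = w := by
  by_contra hzw
  obtain ⟨f, hf, hz⟩ := exists_continuousMap_unitInterval (isOpen_compl_singleton (x := w)) hzw
  have h₀ : f w = 0 := hf w fun h => h rfl
  rw [← h, hz] at h₀
  exact one_ne_zero h₀

/-- Where `ψ` vanishes, the product is squeezed between `0` and `ψ`, so the arbitrary values of `e`
off its source do no harm. This is why all functions take values in the unit interval. -/
theorem continuous_mul_comp_openPartialHomeomorph {Y Z : Type*} [TopologicalSpace Y]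
    [TopologicalSpace Z] (e : OpenPartialHomeomorph Y Z) {ψ : Y → unitInterval}
    {a : Z → unitInterval} (hψ : Continuous ψ) (ha : Continuous a)
    (h₀ : ∀ y ∉ e.source, ψ y = 0) : Continuous fun y => ψ y * a (e y) := by
  refine continuous_iff_continuousAt.2 fun y => ?_
  by_cases hy : y ∈ e.source
  · exact hψ.continuousAt.mul (ha.continuousAt.comp (e.continuousAt hy))
  · have h := hψ.tendsto y
    rw [h₀ y hy] at h
    rw [ContinuousAt, h₀ y hy, zero_mul]
    exact tendsto_of_tendsto_of_tendsto_of_le_of_le tendsto_const_nhds h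
      (fun z => bot_le) fun z => unitInterval.mul_le_left

end UnitInterval

namespace Diagram

variable {C : Type u} [SmallCategory C] {F : Diagram C}

/-- Formal expressions for continuous functions that are natural with respect to equivariant maps
between actions of `F`. -/
inductive Term (F : Diagram C) : Type u
  | orb {x x' : C} (g : x ⟶ x') (f : C((F.X g).right.OrbitSpace, unitInterval))
  | pull (V : F.Slice) (f : C((F.G V.src).Obj, unitInterval))
      (hf : ∀ z ∉ (F.X V.hom).s '' V.carrier, f z = 0) (t : Term F)
  | push (V : F.Slice) (f : C((F.X V.hom).right.OrbitSpace, unitInterval))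
      (hf : ∀ z ∉ (F.X V.hom).right.orbitMk '' V.carrier, f z = 0) (t : Term F)

namespace Action

section Eval

variable {Y : Type u} [TopologicalSpace Y] (b : F.Action Y)

open Classical in
/-- Extension of a function on `Y_x` by zero. -/
noncomputable def extendZero {x : C} (f : b.part x → unitInterval) (y : Y) : unitInterval :=
  if h : y ∈ b.part x then f ⟨y, h⟩ else 0

theorem extendZero_of_mem {x : C} (f : b.part x → unitInterval) {y : Y} (h : y ∈ b.part x) :
    b.extendZero f y = f ⟨y, h⟩ := dif_pos h

theorem extendZero_of_notMem {x : C} (f : b.part x → unitInterval) {y : Y} (h : y ∉ b.part x) :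
    b.extendZero f y = 0 := dif_neg h

theorem continuous_of_forall_part {T : Type*} [TopologicalSpace T] {f : Y → T}
    (hf : ∀ x, Continuous fun y : b.part x => f y) : Continuous f := by
  refine continuous_iff_continuousAt.2 fun y => ?_
  obtain ⟨x, hx, -⟩ := b.existsUnique_part y
  have : ContinuousOn f (b.part x) := continuousOn_iff_continuous_domRestrict.2 (hf x)
  exact this.continuousAt ((b.isClopen_part x).isOpen.mem_nhds hx)

theorem continuous_extendZero {x : C} {f : b.part x → unitInterval} (hf : Continuous f) :
    Continuous (b.extendZero f) := by
  refine b.continuous_of_forall_part fun x' => ?_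
  by_cases h : x' = x
  · subst h
    convert hf using 1
    exact funext fun y => b.extendZero_of_mem f y.2
  · convert continuous_const (y := (0 : unitInterval)) using 1
    exact funext fun y => b.extendZero_of_notMem f fun h' => h (eq_of_mem_part y.2 h')

/-- The value of a formal expression on an action. -/
noncomputable def eval : F.Term → Y → unitInterval
  | .orb g f => b.extendZero fun y => f (b.orb g y)
  | .pull V f _ t => fun y => b.extendZero (fun y => f (b.anchor V.src y)) y * eval t (b.slice V y)
  | .push V f _ t => fun y =>
      b.extendZero (fun y => f (b.orb V.hom y)) y * eval t ((b.slice V).symm y)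

theorem continuous_eval (t : F.Term) : Continuous (b.eval t) := by
  induction t with
  | orb g f => exact b.continuous_extendZero (f.continuous.comp (b.continuous_orb g))
  | pull V f hf t ih =>
    refine continuous_mul_comp_openPartialHomeomorph (b.slice V)
      (b.continuous_extendZero (f.continuous.comp (b.continuous_anchor _))) ih fun y hy => ?_
    by_cases h : y ∈ b.part V.src
    · rw [b.extendZero_of_mem _ h]
      exact hf _ fun h' => hy (b.mem_slice_source.2 ⟨h, h'⟩)
    · exact b.extendZero_of_notMem _ h
  | push V f hf t ih =>
    refine continuous_mul_comp_openPartialHomeomorph (b.slice V).symm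
      (b.continuous_extendZero (f.continuous.comp (b.continuous_orb _))) ih fun y hy => ?_
    by_cases h : y ∈ b.part V.tgt
    · rw [b.extendZero_of_mem _ h]
      exact hf _ fun h' => hy (b.mem_slice_target.2 ⟨h, h'⟩)
    · exact b.extendZero_of_notMem _ h

variable {b} {Z : Type u} [TopologicalSpace Z] {c : F.Action Z} {φ : C(Y, Z)}

theorem IsEquivariant.extendZero_eq (h : b.IsEquivariant c φ) {x : C} {f : b.part x → unitInterval}
    {f' : c.part x → unitInterval}
    (hf : ∀ (y : Y) (hy : y ∈ b.part x), f' ⟨φ y, h.mem_part.2 hy⟩ = f ⟨y, hy⟩) (y : Y) :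
    c.extendZero f' (φ y) = b.extendZero f y := by
  by_cases hy : y ∈ b.part x
  · rw [b.extendZero_of_mem _ hy, c.extendZero_of_mem _ (h.mem_part.2 hy), hf]
  · rw [b.extendZero_of_notMem _ hy, c.extendZero_of_notMem _ (mt h.mem_part.1 hy)]

/-- Slices and their inverses commute with `φ`, and the cut-off factors depend only on anchors and
orbit classes, which `φ` preserves. -/
theorem IsEquivariant.eval_eq (h : b.IsEquivariant c φ) (t : F.Term) (y : Y) :
    c.eval t (φ y) = b.eval t y := by
  induction t generalizing y with
  | orb g f => exact h.extendZero_eq (fun y hy => congrArg f (h.orb_eq g hy)) y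
  | pull V f hf t ih =>
    simp only [eval]
    rw [← h.slice_eq, ih, h.extendZero_eq (f := fun y => f (b.anchor V.src y))
      fun y hy => congrArg f (h.anchor_eq hy)]
  | push V f hf t ih =>
    simp only [eval]
    rw [← h.slice_symm_eq, ih, h.extendZero_eq (f := fun y => f (b.orb V.hom y))
      fun y hy => congrArg f (h.orb_eq V.hom hy)]

end Eval

end Action

/-! ### The fibres of the universal action -/

/-- The space in which the fibre of the universal action at `x` lives. -/
abbrev Coords (F : Diagram C) (x : C) : Type u :=
  (F.G x).Obj × (∀ p : (Σ y : C, (y ⟶ x)), (F.X p.2).right.OrbitSpace) × (F.Term → unitInterval)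

/-- The coordinates of a point in an action. -/
noncomputable def Action.coords {Y : Type u} [TopologicalSpace Y] (b : F.Action Y) {x : C}
    (y : b.part x) : F.Coords x :=
  (b.anchor x y, fun p => b.orb p.2 y, fun t => b.eval t y)

/-- The coordinates of all points in all actions. -/
def realized (F : Diagram C) (x : C) : Set (F.Coords x) :=
  {p | ∃ (Y : Type u) (_ : TopologicalSpace Y) (b : F.Action Y) (y : b.part x), b.coords y = p}

/-- The fibre of the universal action at `x`. -/
abbrev UnivFibre (F : Diagram C) (x : C) : Type u := closure (F.realized x)

namespace UnivFibre

/-- The anchor map. -/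
def anchor {x : C} (ω : F.UnivFibre x) : (F.G x).Obj := ω.1.1

/-- The map to the orbit space of a correspondence. -/
def orb {x x' : C} (g : x ⟶ x') (ω : F.UnivFibre x') : (F.X g).right.OrbitSpace := ω.1.2.1 ⟨x, g⟩

/-- The value of a formal expression. -/
def val {x : C} (t : F.Term) (ω : F.UnivFibre x) : unitInterval := ω.1.2.2 t

theorem continuous_anchor {x : C} : Continuous (anchor : F.UnivFibre x → _) :=
  continuous_fst.comp continuous_subtype_val

theorem continuous_orb {x x' : C} (g : x ⟶ x') : Continuous (orb g : F.UnivFibre x' → _) :=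
  (continuous_apply (A := fun p : (Σ y : C, (y ⟶ x')) => (F.X p.2).right.OrbitSpace) ⟨x, g⟩).comp
    (continuous_fst.comp (continuous_snd.comp continuous_subtype_val))

theorem continuous_val {x : C} (t : F.Term) : Continuous (val t : F.UnivFibre x → _) :=
  (continuous_apply t).comp (continuous_snd.comp (continuous_snd.comp continuous_subtype_val))

end UnivFibre

/-- The point of the universal action given by a point in an action. -/
noncomputable def Action.toFibre {Y : Type u} [TopologicalSpace Y] (b : F.Action Y) {x : C}
    (y : b.part x) : F.UnivFibre x :=
  ⟨b.coords y, subset_closure ⟨Y, _, b, y, rfl⟩⟩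

theorem Action.continuous_toFibre {Y : Type u} [TopologicalSpace Y] (b : F.Action Y) {x : C} :
    Continuous (b.toFibre : b.part x → _) :=
  ((b.continuous_anchor x).prodMk ((continuous_pi fun p => b.continuous_orb p.2).prodMk
    (continuous_pi fun t => (b.continuous_eval t).comp continuous_subtype_val))).subtype_mk _

namespace UnivFibre

/-- Points coming from actual actions are dense, by construction of the fibre as a closure. -/
theorem exists_toFibre_mem {x : C} {U : Set (F.UnivFibre x)} (hU : IsOpen U)
    {ω : F.UnivFibre x} (hω : ω ∈ U) :
    ∃ (Y : Type u) (_ : TopologicalSpace Y) (b : F.Action Y) (y : b.part x), b.toFibre y ∈ U := by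
  obtain ⟨W, hW, rfl⟩ := isOpen_induced_iff.1 hU
  obtain ⟨_, hp, Y, _, b, y, rfl⟩ := mem_closure_iff.1 ω.2 W hW hω
  exact ⟨Y, _, b, y, hp⟩

theorem forall_of_isClosed {x : C} {p : F.UnivFibre x → Prop} (hp : IsClosed {ω | p ω})
    (h : ∀ (Y : Type u) [TopologicalSpace Y] (b : F.Action Y) (y : b.part x), p (b.toFibre y))
    (ω : F.UnivFibre x) : p ω := by
  by_contra hω
  obtain ⟨Y, _, b, y, hy⟩ := exists_toFibre_mem hp.isOpen_compl hω
  exact hy (h Y b y)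

theorem val_orb {x x' : C} (g : x ⟶ x') (f : C((F.X g).right.OrbitSpace, unitInterval))
    (ω : F.UnivFibre x') : val (.orb g f) ω = f (orb g ω) := by
  refine forall_of_isClosed (isClosed_eq (continuous_val _) (f.continuous.comp (continuous_orb g)))
    (fun Y _ b y => ?_) ω
  exact b.extendZero_of_mem (fun y => f (b.orb g y)) y.2

/-- The orbit coordinates are redundant: continuous functions separate points of a compact Hausdorff
orbit space, and each such function is an `orb` expression. -/
theorem ext_of_val [∀ (x y : C) (g : x ⟶ y), CompactSpace (F.X g).right.OrbitSpace]
    [∀ (x y : C) (g : x ⟶ y), T2Space (F.X g).right.OrbitSpace] {x : C} {ω ω' : F.UnivFibre x}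
      (h : anchor ω = anchor ω')
    (hv : ∀ t, val t ω = val t ω') : ω = ω' := by
  refine Subtype.ext (Prod.ext h (Prod.ext (funext fun p => ?_) (funext hv)))
  refine eq_of_forall_continuousMap_unitInterval fun f => ?_
  have := hv (.orb p.2 f)
  rwa [val_orb, val_orb] at this

/-- The graph of the action of a correspondence on the universal action. -/
def actRel {x x' : C} (g : x ⟶ x') : Set (((F.X g).carrier × F.UnivFibre x) × F.UnivFibre x') :=
  closure {p | ∃ (Y : Type u) (_ : TopologicalSpace Y) (b : F.Action Y) (γ : (F.X g).carrier)
    (y : b.part x) (e : (F.X g).s γ = b.anchor x y),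
      p = ((γ, b.toFibre y), b.toFibre (b.act g γ y e))}

theorem toFibre_mem_actRel {x x' : C} {g : x ⟶ x'} {Y : Type u} [TopologicalSpace Y]
    (b : F.Action Y)
    (γ : (F.X g).carrier) (y : b.part x) (e : (F.X g).s γ = b.anchor x y) :
    ((γ, b.toFibre y), b.toFibre (b.act g γ y e)) ∈ actRel g :=
  subset_closure ⟨Y, _, b, γ, y, e, rfl⟩

/-- A closed condition passes from actual products to their limits. Restricting `γ` to an open set
`U` allows conditions that make sense only while `γ` stays in a fixed slice. -/
theorem actRel_induction {x x' : C} {g : x ⟶ x'}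
    {p : ((F.X g).carrier × F.UnivFibre x) × F.UnivFibre x' → Prop}
    {U : Set (F.X g).carrier} (hU : IsOpen U) (hp : IsClosed {q | p q})
    (h : ∀ (Y : Type u) [TopologicalSpace Y] (b : F.Action Y) (γ : (F.X g).carrier) (y : b.part x)
      (e : (F.X g).s γ = b.anchor x y), γ ∈ U →
        p ((γ, b.toFibre y), b.toFibre (b.act g γ y e)))
    {q : ((F.X g).carrier × F.UnivFibre x) × F.UnivFibre x'} (hq : q ∈ actRel g)
    (hqU : q.1.1 ∈ U) : p q := by
  have h₁ := (hU.preimage (continuous_fst.comp continuous_fst)).inter_closure (t := _) ⟨hqU, hq⟩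
  refine closure_minimal ?_ hp h₁
  rintro _ ⟨hγ, Y, _, b, γ, y, e, rfl⟩
  exact h Y b γ y e hγ

/-! ### Limits of the multiplication maps: existence, uniqueness, continuity, openness and
associativity. -/

section Compact

set_option linter.unusedSectionVars false

variable [∀ x, CompactSpace (F.G x).Obj] [∀ x, T2Space (F.G x).Obj]
  [∀ (x y : C) (g : x ⟶ y), CompactSpace (F.X g).right.OrbitSpace]
  [∀ (x y : C) (g : x ⟶ y), T2Space (F.X g).right.OrbitSpace]

instance compactSpace (x : C) : CompactSpace (F.UnivFibre x) :=
  isCompact_iff_compactSpace.1 isClosed_closure.isCompact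

instance t2Space (x : C) : T2Space (F.UnivFibre x) := inferInstance

variable {x x' : C} {g : x ⟶ x'} {γ : (F.X g).carrier} {ω : F.UnivFibre x} {ω' : F.UnivFibre x'}

theorem s_eq_of_mem_actRel (h : ((γ, ω), ω') ∈ actRel g) : (F.X g).s γ = anchor ω :=
  actRel_induction (p := fun q => (F.X g).s q.1.1 = anchor q.1.2) isOpen_univ
    (isClosed_eq ((continuous_s g).comp (continuous_fst.comp continuous_fst))
      (continuous_anchor.comp (continuous_snd.comp continuous_fst)))
    (fun _ _ _ _ _ e _ => e) h (mem_univ _)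

theorem anchor_eq_of_mem_actRel (h : ((γ, ω), ω') ∈ actRel g) : anchor ω' = (F.X g).r γ :=
  actRel_induction (p := fun q => anchor q.2 = (F.X g).r q.1.1) isOpen_univ
    (isClosed_eq (continuous_anchor.comp continuous_snd)
      ((F.X g).left.continuous_anchor.comp (continuous_fst.comp continuous_fst)))
    (fun _ _ b _ _ e _ => b.anchor_act g _ _ e) h (mem_univ _)

theorem orb_eq_of_mem_actRel (h : ((γ, ω), ω') ∈ actRel g) :
    orb g ω' = (F.X g).right.orbitMk γ :=
  actRel_induction (p := fun q => orb g q.2 = (F.X g).right.orbitMk q.1.1) isOpen_univ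
    (isClosed_eq ((continuous_orb g).comp continuous_snd)
      ((F.X g).right.continuous_orbitMk.comp (continuous_fst.comp continuous_fst)))
    (fun _ _ b _ _ e _ => b.orb_act g _ _ e) h (mem_univ _)

/-- Pull `t` back along a slice through `γ`, with a bump function equal to `1` at `s γ`. The
identity saying that the value of the pulled-back expression at `ω` is that of `t` at `ω'` times the
bump is closed, so it holds in the limit and expresses `val t ω'` through `ω`. -/
theorem actRel_right_unique {ω'' : F.UnivFibre x'} (h : ((γ, ω), ω') ∈ actRel g)
    (h' : ((γ, ω), ω'') ∈ actRel g) : ω' = ω'' := by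
  refine ext_of_val ((anchor_eq_of_mem_actRel h).trans (anchor_eq_of_mem_actRel h').symm)
    fun t => ?_
  obtain ⟨V, hV, -, hγ, hs, hq⟩ := exists_slice g γ isOpen_univ (mem_univ _)
  obtain ⟨f, hf, hf₁⟩ := exists_continuousMap_unitInterval (isOpenMap_s g V hV)
    (mem_image_of_mem _ hγ)
  suffices H : ∀ ω', ((γ, ω), ω') ∈ actRel g →
      val (.pull ⟨g, V, hV, hs, hq⟩ f hf t) ω = f ((F.X g).s γ) * val t ω' by
    simpa only [hf₁, one_mul] using (H _ h).symm.trans (H _ h')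
  intro ω' h
  refine actRel_induction (p := fun q => val (.pull ⟨g, V, hV, hs, hq⟩ f hf t) q.1.2 =
    f ((F.X g).s q.1.1) * val t q.2) hV (isClosed_eq
      ((continuous_val _).comp (continuous_snd.comp continuous_fst))
      ((f.continuous.comp ((continuous_s g).comp (continuous_fst.comp continuous_fst))).mul
        ((continuous_val _).comp continuous_snd))) ?_ h hγ
  intro Y _ b γ y e hγ
  change b.eval _ y = _ * b.eval t _
  simp only [Action.eval]
  rw [b.slice_apply ⟨g, V, hV, hs, hq⟩ hγ y e, b.extendZero_of_mem _ y.2, e]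

/-- The mirror argument: push `t` forward along the slice, with the bump function now on the orbit
space. This is the limit form of injectivity of `y ↦ γ · y`. -/
theorem actRel_left_unique {ω₁ : F.UnivFibre x} (h : ((γ, ω), ω') ∈ actRel g)
    (h' : ((γ, ω₁), ω') ∈ actRel g) : ω = ω₁ := by
  refine ext_of_val ((s_eq_of_mem_actRel h).symm.trans (s_eq_of_mem_actRel h')) fun t => ?_
  obtain ⟨V, hV, -, hγ, hs, hq⟩ := exists_slice g γ isOpen_univ (mem_univ _)
  obtain ⟨f, hf, hf₁⟩ := exists_continuousMap_unitInterval
    ((F.X g).right.isOpenMap_orbitMk V hV) (mem_image_of_mem _ hγ)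
  suffices H : ∀ ω, ((γ, ω), ω') ∈ actRel g →
      val (.push ⟨g, V, hV, hs, hq⟩ f hf t) ω' = f ((F.X g).right.orbitMk γ) * val t ω by
    simpa only [hf₁, one_mul] using (H _ h).symm.trans (H _ h')
  intro ω h
  refine actRel_induction (p := fun q => val (.push ⟨g, V, hV, hs, hq⟩ f hf t) q.2 =
    f ((F.X g).right.orbitMk q.1.1) * val t q.1.2) hV (isClosed_eq
      ((continuous_val _).comp continuous_snd)
      ((f.continuous.comp ((F.X g).right.continuous_orbitMk.comp
        (continuous_fst.comp continuous_fst))).mul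
        ((continuous_val _).comp (continuous_snd.comp continuous_fst)))) ?_ h hγ
  intro Y _ b γ y e hγ
  change b.eval _ _ = _ * b.eval t _
  simp only [Action.eval]
  rw [b.slice_symm_apply ⟨g, V, hV, hs, hq⟩ hγ y e,
    b.extendZero_of_mem _ (b.act g γ y e).2, b.orb_act]

/-- The pairs with a product form a closed set, because projecting out a compact factor is a closed
map. They are dense among compatible pairs: approximate `ω` by an actual point and use that `s` is
open to adjust `γ` to its anchor. -/
theorem exists_actRel_right (e : (F.X g).s γ = anchor ω) : ∃ ω', ((γ, ω), ω') ∈ actRel g := by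
  have hc : IsClosed (Prod.fst '' (actRel g)) :=
    isClosedMap_fst_of_compactSpace (Y := F.UnivFibre x') _ isClosed_closure
  suffices h : (γ, ω) ∈ Prod.fst '' (actRel g) by
    obtain ⟨⟨_, ω'⟩, h, rfl⟩ := h
    exact ⟨ω', h⟩
  rw [← hc.closure_eq, mem_closure_iff]
  intro O hO hm
  obtain ⟨N₁, N₂, h₁, h₂, hγ, hω, hN⟩ := isOpen_prod_iff.1 hO γ ω hm
  obtain ⟨Y, _, b, y, hy, γ', hγ', e'⟩ := exists_toFibre_mem
    (h₂.inter ((isOpenMap_s g N₁ h₁).preimage continuous_anchor)) ⟨hω, γ, hγ, e⟩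
  exact ⟨(γ', b.toFibre y), hN (mk_mem_prod hγ' hy), _, toFibre_mem_actRel b γ' y e', rfl⟩

/-- As for products, but `γ` is adjusted through the open orbit map; an actual point in the orbit
class of `γ'` is divisible by `γ'`. -/
theorem exists_actRel_left (e : (F.X g).right.orbitMk γ = orb g ω') :
    ∃ ω, ((γ, ω), ω') ∈ actRel g := by
  let swap : ((F.X g).carrier × F.UnivFibre x') × F.UnivFibre x →
      ((F.X g).carrier × F.UnivFibre x) × F.UnivFibre x' := fun q => ((q.1.1, q.2), q.1.2)
  have hsw : Continuous swap := by fun_prop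
  have hc : IsClosed (Prod.fst '' (swap ⁻¹' (actRel g))) :=
    isClosedMap_fst_of_compactSpace _ (isClosed_closure.preimage hsw)
  suffices h : (γ, ω') ∈ Prod.fst '' (swap ⁻¹' (actRel g)) by
    obtain ⟨⟨_, ω⟩, h, rfl⟩ := h
    exact ⟨ω, h⟩
  rw [← hc.closure_eq, mem_closure_iff]
  intro O hO hm
  obtain ⟨N₁, N₂, h₁, h₂, hγ, hω, hN⟩ := isOpen_prod_iff.1 hO γ ω' hm
  obtain ⟨Y, _, b, y, hy, γ', hγ', e'⟩ := exists_toFibre_mem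
    (h₂.inter (((F.X g).right.isOpenMap_orbitMk N₁ h₁).preimage (continuous_orb g)))
    ⟨hω, γ, hγ, e⟩
  obtain ⟨y₀, e₀, rfl⟩ := b.exists_act_eq_of_orb_eq g γ' y e'.symm
  exact ⟨(γ', b.toFibre _), hN (mk_mem_prod hγ' hy), ((γ', _), b.toFibre y₀),
    toFibre_mem_actRel b γ' y₀ e₀, rfl⟩

/-- The action of a correspondence on the universal action. -/
noncomputable def act (g : x ⟶ x') (γ : (F.X g).carrier) (ω : F.UnivFibre x)
    (e : (F.X g).s γ = anchor ω) : F.UnivFibre x' :=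
  (exists_actRel_right e).choose

theorem act_mem_actRel (e : (F.X g).s γ = anchor ω) : ((γ, ω), act g γ ω e) ∈ actRel g :=
  (exists_actRel_right e).choose_spec

theorem eq_act_iff (e : (F.X g).s γ = anchor ω) : ω' = act g γ ω e ↔ ((γ, ω), ω') ∈ actRel g :=
  ⟨fun h => h ▸ act_mem_actRel e, fun h => actRel_right_unique h (act_mem_actRel e)⟩

theorem act_toFibre {Y : Type u} [TopologicalSpace Y] (b : F.Action Y)
    (γ : (F.X g).carrier) (y : b.part x) (e : (F.X g).s γ = b.anchor x y) :
    act g γ (b.toFibre y) e = b.toFibre (b.act g γ y e) :=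
  ((eq_act_iff e).2 (toFibre_mem_actRel b γ y e)).symm

theorem anchor_act (e : (F.X g).s γ = anchor ω) : anchor (act g γ ω e) = (F.X g).r γ :=
  anchor_eq_of_mem_actRel (act_mem_actRel e)

theorem orb_act (e : (F.X g).s γ = anchor ω) :
    orb g (act g γ ω e) = (F.X g).right.orbitMk γ :=
  orb_eq_of_mem_actRel (act_mem_actRel e)

theorem act_injective {ω₁ : F.UnivFibre x} (e : (F.X g).s γ = anchor ω)
    (e₁ : (F.X g).s γ = anchor ω₁) (h : act g γ ω e = act g γ ω₁ e₁) : ω = ω₁ :=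
  actRel_left_unique (act_mem_actRel e) (h ▸ act_mem_actRel e₁)

theorem continuous_act (g : x ⟶ x') :
    Continuous fun p : {p : (F.X g).carrier × F.UnivFibre x // (F.X g).s p.1 = anchor p.2} =>
      act g p.1.1 p.1.2 p.2 :=
  continuous_of_isClosed_graph_of_compactSpace (R := {q : {p : (F.X g).carrier × F.UnivFibre x //
      (F.X g).s p.1 = anchor p.2} × F.UnivFibre x' | (q.1.1, q.2) ∈ actRel g})
    (isClosed_closure.preimage (by fun_prop)) fun p _ => (eq_act_iff p.2).symm

theorem surjective_act (g : x ⟶ x') :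
    Function.Surjective
      fun p : {p : (F.X g).carrier × F.UnivFibre x // (F.X g).s p.1 = anchor p.2} =>
        act g p.1.1 p.1.2 p.2 := by
  intro ω'
  obtain ⟨γ, hγ⟩ := (F.X g).right.orbitMk_surjective (orb g ω')
  obtain ⟨ω, hω⟩ := exists_actRel_left hγ
  exact ⟨⟨(γ, ω), s_eq_of_mem_actRel hω⟩, ((eq_act_iff _).2 hω).symm⟩

theorem isOpenMap_act (g : x ⟶ x') :
    IsOpenMap fun p : {p : (F.X g).carrier × F.UnivFibre x // (F.X g).s p.1 = anchor p.2} =>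
      act g p.1.1 p.1.2 p.2 := by
  let D := {p : (F.X g).carrier × F.UnivFibre x' // (F.X g).right.orbitMk p.1 = orb g p.2}
  -- Division `(γ, ω') ↦ ω` is a function by left uniqueness and continuous by the closed graph
  -- theorem. It identifies the domain of the action map with `D`, whose projection to `ω'` is open
  -- because the orbit map is.
  choose c hc using fun p : D => exists_actRel_left p.2
  have hcont : Continuous c :=
    continuous_of_isClosed_graph_of_compactSpace
      (R := {q : D × F.UnivFibre x | ((q.1.1.1, q.2), q.1.1.2) ∈ actRel g})
      (isClosed_closure.preimage (((((continuous_fst.comp continuous_subtype_val).comp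
        continuous_fst).prodMk continuous_snd)).prodMk
        ((continuous_snd.comp continuous_subtype_val).comp continuous_fst))) fun p ω =>
        ⟨fun h => actRel_left_unique h (hc p), fun h => h ▸ hc p⟩
  intro U hU
  have : (fun p : {p : (F.X g).carrier × F.UnivFibre x // (F.X g).s p.1 = anchor p.2} =>
      act g p.1.1 p.1.2 p.2) '' U = (fun p : D => p.1.2) '' ((fun p : D =>
        (⟨(p.1.1, c p), s_eq_of_mem_actRel (hc p)⟩ :
          {p : (F.X g).carrier × F.UnivFibre x // (F.X g).s p.1 = anchor p.2})) ⁻¹' U) := by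
    ext ω'
    constructor
    · rintro ⟨⟨⟨γ, ω⟩, e⟩, h, rfl⟩
      let p : D := ⟨(γ, act g γ ω e), (orb_act e).symm⟩
      have hp : c p = ω := actRel_left_unique (hc p) (act_mem_actRel e)
      refine ⟨p, ?_, rfl⟩
      simpa only [mem_preimage, hp] using h
    · rintro ⟨p, h, rfl⟩
      exact ⟨_, h, ((eq_act_iff _).2 (hc p)).symm⟩
  rw [this]
  exact isOpenMap_fibreProd_snd (F.X g).right.isOpenMap_orbitMk (continuous_orb g) _
    (hU.preimage (((continuous_fst.comp continuous_subtype_val).prodMk hcont).subtype_mk _))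

theorem act_act {x'' : C} (g₁ : x' ⟶ x'') (g₂ : x ⟶ x') (k : x ⟶ x'') (hk : g₂ ≫ g₁ = k)
    (γ₁ : (F.X g₁).carrier) (γ₂ : (F.X g₂).carrier) (ω : F.UnivFibre x)
    (e₁ : (F.X g₁).s γ₁ = (F.X g₂).r γ₂) (e₂ : (F.X g₂).s γ₂ = anchor ω) :
    act g₁ γ₁ (act g₂ γ₂ ω e₂) (e₁.trans (anchor_act e₂).symm) =
      act k (F.mul g₁ g₂ k hk γ₁ γ₂ e₁) ω ((s_mul g₁ g₂ k hk γ₁ γ₂ e₁).trans e₂) := by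
  rw [eq_act_iff]
  let T := {p : (F.X g₁).carrier × (F.X g₂).carrier × F.UnivFibre x //
    (F.X g₁).s p.1 = (F.X g₂).r p.2.1 ∧ (F.X g₂).s p.2.1 = anchor p.2.2}
  let Φ₁ : T → F.UnivFibre x' := fun p => act g₂ p.1.2.1 p.1.2.2 p.2.2
  have hΦ₁ : Continuous Φ₁ := (continuous_act g₂).comp (Continuous.subtype_mk
    (f := fun p : T => (p.1.2.1, p.1.2.2)) (by fun_prop) fun p => p.2.2)
  let Φ : T → ((F.X k).carrier × F.UnivFibre x) × F.UnivFibre x'' := fun p =>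
    ((F.mul g₁ g₂ k hk p.1.1 p.1.2.1 p.2.1, p.1.2.2),
      act g₁ p.1.1 (Φ₁ p) (p.2.1.trans (anchor_act p.2.2).symm))
  have hΦ : Continuous Φ := by
    refine Continuous.prodMk (Continuous.prodMk ?_ (by fun_prop)) ?_
    · exact (continuous_mul g₁ g₂ k hk).comp (Continuous.subtype_mk
        (f := fun p : T => (p.1.1, p.1.2.1)) (by fun_prop) fun p => p.2.1)
    · exact (continuous_act g₁).comp (Continuous.subtype_mk
        (f := fun p : T => (p.1.1, Φ₁ p)) (by fun_prop)
        fun p => p.2.1.trans (anchor_act p.2.2).symm)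
  suffices H : ∀ p : T, Φ p ∈ actRel k from H ⟨(γ₁, γ₂, ω), e₁, e₂⟩
  intro p
  -- If associativity failed at `p`, it would fail on an open set of composable triples. Openness of
  -- both source maps yields in it a triple whose last entry comes from an actual action, where
  -- associativity holds.
  have hcl : IsClosed (Φ ⁻¹' (actRel k)) := isClosed_closure.preimage hΦ
  by_contra hp
  obtain ⟨W, hW, hWe⟩ := isOpen_induced_iff.1 hcl.isOpen_compl
  have hpW : p ∈ Subtype.val ⁻¹' W := hWe ▸ hp
  obtain ⟨N₁, N', h₁, h', hp₁, hp', hN⟩ := isOpen_prod_iff.1 hW p.1.1 p.1.2 hpW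
  obtain ⟨N₂, N₃, h₂, h₃, hp₂, hp₃, hN'⟩ := isOpen_prod_iff.1 h' p.1.2.1 p.1.2.2 hp'
  obtain ⟨Y, _, b, y, hy, γ₂, ⟨hγ₂, γ₁, hγ₁, d₁⟩, d₂⟩ := exists_toFibre_mem
    (h₃.inter ((isOpenMap_s g₂ _ (h₂.inter ((isOpenMap_s g₁ N₁ h₁).preimage
      (F.X g₂).left.continuous_anchor))).preimage continuous_anchor))
    ⟨hp₃, p.1.2.1, ⟨hp₂, p.1.1, hp₁, p.2.1⟩, p.2.2⟩
  let p' : T := ⟨(γ₁, γ₂, b.toFibre y), d₁, d₂⟩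
  have hp' : p' ∈ (Φ ⁻¹' (actRel k))ᶜ := by
    rw [← hWe]
    exact hN (mk_mem_prod hγ₁ (hN' (mk_mem_prod hγ₂ hy)))
  refine hp' ?_
  change ((F.mul g₁ g₂ k hk γ₁ γ₂ d₁, b.toFibre y),
    act g₁ γ₁ (act g₂ γ₂ (b.toFibre y) d₂) _) ∈ actRel k
  have d₂' : (F.X g₂).s γ₂ = b.anchor x y := d₂
  simp only [act_toFibre b γ₂ y d₂',
    act_toFibre b γ₁ _ (d₁.trans (b.anchor_act g₂ γ₂ y d₂').symm)]
  rw [b.act_act' g₁ g₂ k hk γ₁ γ₂ y d₁ d₂']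
  exact toFibre_mem_actRel b _ y _

end Compact

end UnivFibre

/-! ### The universal action -/

section Universal

/-- The space of the universal action. -/
abbrev Univ (F : Diagram C) : Type u := Σ x : C, F.UnivFibre x

/-- The fibres of the universal action as clopen subsets. -/
noncomputable def univFibreHomeo (F : Diagram C) (x : C) :
    F.UnivFibre x ≃ₜ range (Sigma.mk x : F.UnivFibre x → F.Univ) :=
  (IsOpenEmbedding.sigmaMk (σ := fun x => F.UnivFibre x)).isEmbedding.toHomeomorph

theorem univFibreHomeo_symm_mk {x : C} (ω : F.UnivFibre x)
    (h : (⟨x, ω⟩ : F.Univ) ∈ range (Sigma.mk x)) : (F.univFibreHomeo x).symm ⟨⟨x, ω⟩, h⟩ = ω :=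
  (F.univFibreHomeo x).symm_apply_apply ω

/-- Compatible pairs for the universal action. -/
noncomputable def univFibreProdHomeo {x x' : C} (g : x ⟶ x') :
    {p : (F.X g).carrier × range (Sigma.mk x : F.UnivFibre x → F.Univ) //
      (F.X g).s p.1 = UnivFibre.anchor ((F.univFibreHomeo x).symm p.2)} ≃ₜ
    {p : (F.X g).carrier × F.UnivFibre x // (F.X g).s p.1 = UnivFibre.anchor p.2} :=
  ((Homeomorph.refl _).prodCongr (F.univFibreHomeo x).symm).subtype fun _ => Iff.rfl

/-- The canonical map to the universal action. -/
noncomputable def Action.toUniv {Y : Type u} [TopologicalSpace Y] (b : F.Action Y) (y : Y) :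
    F.Univ :=
  ⟨(b.existsUnique_part y).choose, b.toFibre ⟨y, (b.existsUnique_part y).choose_spec.1⟩⟩

theorem Action.toUniv_eq {Y : Type u} [TopologicalSpace Y] (b : F.Action Y) {x : C} {y : Y}
    (h : y ∈ b.part x) : b.toUniv y = ⟨x, b.toFibre ⟨y, h⟩⟩ := by
  obtain rfl := (b.existsUnique_part y).choose_spec.2 x h
  rfl

theorem Action.continuous_toUniv {Y : Type u} [TopologicalSpace Y] (b : F.Action Y) :
    Continuous b.toUniv := by
  refine b.continuous_of_forall_part fun x => ?_
  have : (fun y : b.part x => b.toUniv y) = fun y => ⟨x, b.toFibre y⟩ :=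
    funext fun y => b.toUniv_eq y.2
  rw [this]
  exact continuous_sigmaMk.comp b.continuous_toFibre

/-- The universal action of a diagram. -/
noncomputable def univAction (F : Diagram C) [∀ x, CompactSpace (F.G x).Obj]
    [∀ x, T2Space (F.G x).Obj]
    [∀ (x y : C) (g : x ⟶ y), CompactSpace (F.X g).right.OrbitSpace]
    [∀ (x y : C) (g : x ⟶ y), T2Space (F.X g).right.OrbitSpace] : F.Action F.Univ where
  part x := range (Sigma.mk x)
  isClopen_part x := isClopen_range_sigmaMk
  existsUnique_part := by
    rintro ⟨x, ω⟩
    refine ⟨x, ⟨ω, rfl⟩, ?_⟩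
    rintro x' ⟨ω', h⟩
    exact congrArg Sigma.fst h
  anchor x y := UnivFibre.anchor ((F.univFibreHomeo x).symm y)
  continuous_anchor x := UnivFibre.continuous_anchor.comp (F.univFibreHomeo x).symm.continuous
  act {x x'} g γ y e := F.univFibreHomeo x' (UnivFibre.act g γ ((F.univFibreHomeo x).symm y) e)
  continuous_act {x x'} g := (F.univFibreHomeo x').continuous.comp
    ((UnivFibre.continuous_act g).comp (univFibreProdHomeo g).continuous)
  isOpenMap_act {x x'} g := (F.univFibreHomeo x').isOpenMap.comp
    ((UnivFibre.isOpenMap_act g).comp (univFibreProdHomeo g).isOpenMap)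
  surjective_act {x x'} g := (F.univFibreHomeo x').surjective.comp
    ((UnivFibre.surjective_act g).comp (univFibreProdHomeo g).surjective)
  anchor_act {x x'} g γ y e := by
    rw [Homeomorph.symm_apply_apply, UnivFibre.anchor_act]
  act_act {x x' x''} g₁ g₂ γ₁ γ₂ y e₁ e₂ := by
    simp only [Homeomorph.symm_apply_apply]
    exact congrArg (F.univFibreHomeo x'') (UnivFibre.act_act g₁ g₂ _ rfl γ₁ γ₂ _ e₁ e₂)
  exists_of_act_eq {x x'} g γ γ' y y' e e' h := by
    replace h := (F.univFibreHomeo x').injective h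
    have ho : (F.X g).right.orbitMk γ = (F.X g).right.orbitMk γ' := by
      rw [← UnivFibre.orb_act e, h, UnivFibre.orb_act]
    -- Equality of products forces equal orbit classes, which provides `η`; cancelling `γ` from `γ ·
    -- y = γ · (η · y')` then gives `y = η · y'`.
    obtain ⟨η, d, rfl⟩ := RightAction.orbitMk_eq_iff.1 ho
    have d' : (F.G x).s η = UnivFibre.anchor ((F.univFibreHomeo x).symm y') :=
      ((F.X g).right.anchor_smul γ η d).symm.trans e'
    refine ⟨η, d, d', rfl, ?_⟩
    rw [← Homeomorph.symm_apply_eq]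
    refine UnivFibre.act_injective e ((d.trans ((F.ι x).r_apply η).symm).trans
      (UnivFibre.anchor_act _).symm) (h.trans ?_)
    rw [UnivFibre.act_act g (𝟙 x) g (Category.id_comp g) γ ((F.ι x).toHomeomorph η) _
      (d.trans ((F.ι x).r_apply η).symm) (((F.ι x).s_apply η).trans d')]
    congr 1
    exact (F.μ_unit_right g γ η d).symm

variable [∀ x, CompactSpace (F.G x).Obj] [∀ x, T2Space (F.G x).Obj]
  [∀ (x y : C) (g : x ⟶ y), CompactSpace (F.X g).right.OrbitSpace]
  [∀ (x y : C) (g : x ⟶ y), T2Space (F.X g).right.OrbitSpace]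

theorem univAction_anchor_mk {x : C} (ω : F.UnivFibre x)
    (h : (⟨x, ω⟩ : F.Univ) ∈ F.univAction.part x) :
    F.univAction.anchor x ⟨⟨x, ω⟩, h⟩ = UnivFibre.anchor ω :=
  congrArg UnivFibre.anchor (univFibreHomeo_symm_mk ω h)

theorem univAction_act_mk {x x' : C} (g : x ⟶ x') (γ : (F.X g).carrier) (ω : F.UnivFibre x)
    (h : (⟨x, ω⟩ : F.Univ) ∈ F.univAction.part x)
    (e : (F.X g).s γ = F.univAction.anchor x ⟨⟨x, ω⟩, h⟩) :
    (F.univAction.act g γ ⟨⟨x, ω⟩, h⟩ e : F.Univ) =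
      ⟨x', UnivFibre.act g γ ω (e.trans (univAction_anchor_mk ω h))⟩ := by
  have h' := univFibreHomeo_symm_mk ω h
  have : F.univAction.act g γ ⟨⟨x, ω⟩, h⟩ e =
    F.univFibreHomeo x' (UnivFibre.act g γ ((F.univFibreHomeo x).symm ⟨⟨x, ω⟩, h⟩) e) := rfl
  rw [this]
  simp only [h']
  rfl

variable {Y : Type u} [TopologicalSpace Y] (b : F.Action Y)

theorem Action.isEquivariant_toUniv :
    b.IsEquivariant F.univAction ⟨b.toUniv, b.continuous_toUniv⟩ := by
  have hp : ∀ (x : C) (y : b.part x), b.toUniv y ∈ F.univAction.part x :=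
    fun x y => ⟨b.toFibre y, (b.toUniv_eq y.2).symm⟩
  have hy : ∀ (x : C) (y : b.part x), (⟨b.toUniv y, hp x y⟩ : F.univAction.part x) =
      ⟨⟨x, b.toFibre y⟩, b.toUniv_eq y.2 ▸ hp x y⟩ := fun x y => Subtype.ext (b.toUniv_eq y.2)
  have hr : ∀ (x : C) (y : b.part x),
      F.univAction.anchor x ⟨b.toUniv y, hp x y⟩ = b.anchor x y := fun x y => by
    rw [hy, univAction_anchor_mk]
    rfl
  refine ⟨hp, hr, ?_⟩
  intro x x' g γ y e
  refine (b.toUniv_eq (b.act g γ y e).2).trans ?_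
  rw [← UnivFibre.act_toFibre b γ y e]
  refine Eq.trans ?_ (congrArg Subtype.val (F.univAction.act_congr g rfl (hy x y)
    (e.trans (hr x y).symm) (e.trans (univAction_anchor_mk (b.toFibre y) _).symm)).symm)
  rw [univAction_act_mk]

/-- Both sides are continuous in `ω`, and they agree on points of actual actions because the
canonical map to the universal action is equivariant and evaluation is natural. -/
theorem univAction_eval_mk {x : C} (ω : F.UnivFibre x) (t : F.Term) :
    F.univAction.eval t ⟨x, ω⟩ = UnivFibre.val t ω := by
  refine UnivFibre.forall_of_isClosed (isClosed_eq ((F.univAction.continuous_eval t).comp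
    continuous_sigmaMk) (UnivFibre.continuous_val t)) (fun Y _ b y => ?_) ω
  change F.univAction.eval t ⟨x, b.toFibre y⟩ = b.eval t y
  rw [← b.isEquivariant_toUniv.eval_eq, ContinuousMap.coe_mk, b.toUniv_eq y.2]

theorem isUniversal_univAction : F.univAction.IsUniversal := by
  intro Y _ b
  refine ⟨_, b.isEquivariant_toUniv, fun φ hφ => ContinuousMap.ext fun y => ?_⟩
  obtain ⟨x, hx, -⟩ := b.existsUnique_part y
  obtain ⟨ω, hω⟩ := hφ.mem_part.2 hx
  refine Eq.trans ?_ (b.toUniv_eq hx).symm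
  refine hω.symm.trans (congrArg (Sigma.mk x) ?_)
  -- Any equivariant map preserves anchors and all values of expressions, and these are coordinates
  -- that determine the image point.
  refine UnivFibre.ext_of_val ?_ fun t => ?_
  · rw [← univAction_anchor_mk ω ⟨ω, rfl⟩]
    refine Eq.trans ?_ (hφ.anchor_eq hx)
    congr 1
    exact Subtype.ext hω
  · rw [← univAction_eval_mk, hω]
    exact hφ.eval_eq t y

end Universal

/-- Any two universal actions live on homeomorphic spaces. -/
noncomputable def Action.IsUniversal.homeomorph {Ω Ω' : Type u} [TopologicalSpace Ω]
    [TopologicalSpace Ω'] {a : F.Action Ω} {a' : F.Action Ω'} (h : a.IsUniversal)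
    (h' : a'.IsUniversal) : Ω ≃ₜ Ω' where
  toFun := (h' Ω a).choose
  invFun := (h Ω' a').choose
  left_inv y := by
    have := (h Ω a).unique ((h Ω' a').choose_spec.1.comp (h' Ω a).choose_spec.1)
      (Action.IsEquivariant.refl a)
    exact congrArg (fun f : C(Ω, Ω) => f y) this
  right_inv y := by
    have := (h' Ω' a').unique ((h' Ω a).choose_spec.1.comp (h Ω' a').choose_spec.1)
      (Action.IsEquivariant.refl a')
    exact congrArg (fun f : C(Ω', Ω') => f y) this
  continuous_toFun := (h' Ω a).choose.continuous
  continuous_invFun := (h Ω' a').choose.continuous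

end Diagram

end GroupoidDiagrams

namespace GroupoidDiagrams

open Set Filter Topology

/-! ### Continuity and openness through open quotient maps and local homeomorphisms. -/

section Topology

/-- Unlike general quotient maps, open ones stay quotient maps after products and after restriction
to preimages. This is what allows continuity to be tested on representatives of composable pairs of
germs. -/
theorem continuous_of_isOpenQuotientMap_restrict {A B T : Type*} [TopologicalSpace A]
    [TopologicalSpace B] [TopologicalSpace T] {q : A → B} (hq : IsOpenQuotientMap q) (S : Set B)
    {f : S → T} (hf : Continuous fun a : q ⁻¹' S => f ⟨q a, a.2⟩) : Continuous f := by
  have h : IsOpenQuotientMap (S.restrictPreimage q) :=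
    ⟨S.restrictPreimage_surjective hq.surjective, hq.continuous.restrictPreimage,
      hq.isOpenMap.restrictPreimage S⟩
  exact h.continuous_comp_iff.1 hf

theorem _root_.IsLocalHomeomorph.isOpenMap_of_comp {A B D : Type*} [TopologicalSpace A]
    [TopologicalSpace B] [TopologicalSpace D] {g : B → D} {f : A → B} (hg : IsLocalHomeomorph g)
    (hf : Continuous f) (hgf : IsOpenMap (g ∘ f)) : IsOpenMap f := by
  intro U hU
  rw [isOpen_iff_mem_nhds]
  rintro _ ⟨a, ha, rfl⟩
  obtain ⟨W, hW, haW, hi⟩ := hg.exists_isOpen_injOn (f a)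
  have hO := hgf _ (hU.inter (hW.preimage hf))
  refine mem_of_superset ((hW.inter (hO.preimage hg.continuous)).mem_nhds
    ⟨haW, ⟨a, ⟨ha, haW⟩, rfl⟩⟩) ?_
  rintro b ⟨hb, a', ⟨ha', ha'W⟩, h⟩
  exact ⟨a', ha', hi ha'W hb h⟩

end Topology

/-! ### Actions of étale groupoids -/

namespace LeftAction

variable {G : EtaleGroupoid.{u}} {Y : Type u} [TopologicalSpace Y] (a : LeftAction G Y)

theorem smul_congr {g g' : G.Arr} {y y' : Y} (hg : g = g') (hy : y = y') (e : G.s g = a.anchor y)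
    (e' : G.s g' = a.anchor y') : a.smul g y e = a.smul g' y' e' := by
  subst hg hy; rfl

theorem inv_smul_smul (g : G.Arr) (y : Y) (e : G.s g = a.anchor y)
    (e' : G.s (G.inv g) = a.anchor (a.smul g y e)) : a.smul (G.inv g) (a.smul g y e) e' = y := by
  rw [← a.mul_smul (G.inv g) g y (G.s_inv g) e]
  refine Eq.trans ?_ (a.unit_smul y)
  exact a.smul_congr ((G.inv_mul g).trans (congrArg G.unit e)) rfl _ _

theorem smul_inv_smul (g : G.Arr) (y : Y) (e : G.s (G.inv g) = a.anchor y)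
    (e' : G.s g = a.anchor (a.smul (G.inv g) y e)) : a.smul g (a.smul (G.inv g) y e) e' = y := by
  rw [← a.mul_smul g (G.inv g) y (G.r_inv g).symm e]
  refine Eq.trans ?_ (a.unit_smul y)
  exact a.smul_congr ((G.mul_inv g).trans (congrArg G.unit ((G.s_inv g).symm.trans e))) rfl _ _

theorem smul_injective (g : G.Arr) {y y' : Y} (e : G.s g = a.anchor y) (e' : G.s g = a.anchor y')
    (h : a.smul g y e = a.smul g y' e') : y = y' := by
  rw [← a.inv_smul_smul g y e ((G.s_inv g).trans (a.anchor_smul g y e).symm),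
    ← a.inv_smul_smul g y' e' ((G.s_inv g).trans (a.anchor_smul g y' e').symm)]
  exact a.smul_congr rfl h _ _

/-- Acting by inverses identifies the domain with pairs `(g, g · y)`, whose second projection is
open because `r` is open. -/
theorem isOpenMap_smul :
    IsOpenMap fun p : {p : G.Arr × Y // G.s p.1 = a.anchor p.2} => a.smul p.1.1 p.1.2 p.2 := by
  let D := {p : G.Arr × Y // G.r p.1 = a.anchor p.2}
  let c : D → Y := fun p => a.smul (G.inv p.1.1) p.1.2 ((G.s_inv _).trans p.2)
  have hc : Continuous c := a.continuous_smul.comp (Continuous.subtype_mk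
    (f := fun p : D => (G.inv p.1.1, p.1.2))
    ((G.continuous_inv.comp (continuous_fst.comp continuous_subtype_val)).prodMk
      (continuous_snd.comp continuous_subtype_val)) fun p => (G.s_inv _).trans p.2)
  have hcs : ∀ p : D, G.s p.1.1 = a.anchor (c p) := fun p =>
    ((a.anchor_smul _ _ _).trans (G.r_inv _)).symm
  intro U hU
  have : (fun p : {p : G.Arr × Y // G.s p.1 = a.anchor p.2} => a.smul p.1.1 p.1.2 p.2) '' U =
      (fun p : D => p.1.2) '' ((fun p : D => (⟨(p.1.1, c p), hcs p⟩ :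
        {p : G.Arr × Y // G.s p.1 = a.anchor p.2})) ⁻¹' U) := by
    ext y'
    constructor
    · rintro ⟨⟨⟨g, y⟩, e⟩, h, rfl⟩
      refine ⟨⟨(g, a.smul g y e), (a.anchor_smul g y e).symm⟩, ?_, rfl⟩
      have : c ⟨(g, a.smul g y e), (a.anchor_smul g y e).symm⟩ = y := a.inv_smul_smul g y e _
      simpa only [mem_preimage, this] using h
    · rintro ⟨p, h, rfl⟩
      exact ⟨_, h, a.smul_inv_smul p.1.1 p.1.2 _ (hcs p)⟩
  rw [this]
  exact isOpenMap_fibreProd_snd G.isLocalHomeomorph_r.isOpenMap a.continuous_anchor _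
    (hU.preimage (((continuous_fst.comp continuous_subtype_val).prodMk hc).subtype_mk _))

variable {a} in
-- Lets naturality of the correspondence between actions yield its injectivity.
theorem eq_of_isEquivariant_id {a' : LeftAction G Y} (h : a.IsEquivariant a' (ContinuousMap.id Y)) :
    a = a' := by
  obtain ⟨h₁, h₂⟩ := h
  obtain ⟨anchor, smul⟩ := a
  obtain ⟨anchor', smul'⟩ := a'
  obtain rfl : anchor' = anchor := funext h₁
  obtain rfl : smul = smul' := by
    funext g y e
    exact h₂ g y e
  rfl

variable (G) in
/-- The canonical action of a groupoid on its object space. -/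
def onObj : LeftAction G G.Obj where
  anchor := id
  smul g _ _ := G.r g
  continuous_anchor := continuous_id
  continuous_smul := G.isLocalHomeomorph_r.continuous.comp
    (continuous_fst.comp continuous_subtype_val)
  anchor_smul _ _ _ := rfl
  mul_smul g h _ e _ := G.r_mul g h e
  unit_smul y := G.r_unit y

/-- The anchor map is the only equivariant map to the object space, which is therefore a terminal
action. -/
theorem isEquivariant_onObj_iff {φ : C(Y, G.Obj)} :
    a.IsEquivariant (onObj G) φ ↔ ∀ y, φ y = a.anchor y :=
  ⟨fun h => h.1, fun h => ⟨h, fun g y e => (h _).trans (a.anchor_smul g y e)⟩⟩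

end LeftAction

namespace Diagram

variable {C : Type u} [SmallCategory C] {F : Diagram C}

theorem Action.eq_of_isEquivariant_id {Y : Type u} [TopologicalSpace Y] {b c : F.Action Y}
    (h : b.IsEquivariant c (ContinuousMap.id Y)) : b = c := by
  have hp : b.part = c.part := funext fun x => Set.ext fun y => h.mem_part.symm
  obtain ⟨h₁, h₂, h₃⟩ := h
  obtain ⟨part, _, _, anchor, _, act⟩ := b
  obtain ⟨part', _, _, anchor', _, act'⟩ := c
  obtain rfl : part = part' := hp
  obtain rfl : anchor' = anchor := by
    funext x y
    exact h₂ x y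
  obtain rfl : @act = @act' := by
    funext x x' g γ y e
    exact Subtype.ext (h₃ g γ y e)
  rfl

/-! ### Words of slices -/

/-- Words of slices and formal inverses of slices. -/
abbrev Word (F : Diagram C) : Type u := List (F.Slice × Bool)

instance : TopologicalSpace F.Word := ⊥

instance : DiscreteTopology F.Word := ⟨rfl⟩

/-- The formal inverse of a word. -/
def Word.inv (w : F.Word) : F.Word := (w.map fun l => (l.1, !l.2)).reverse

namespace Action

section Word

variable {Y : Type u} [TopologicalSpace Y] (b : F.Action Y)

/-- The partial homeomorphism given by a slice or its inverse. -/
noncomputable def letter : F.Slice × Bool → OpenPartialHomeomorph Y Y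
  | (V, true) => b.slice V
  | (V, false) => (b.slice V).symm

/-- The partial homeomorphism given by a word. -/
noncomputable def word : F.Word → OpenPartialHomeomorph Y Y
  | [] => .refl Y
  | l :: w => (word w).trans (b.letter l)

theorem word_append (w w' : F.Word) : b.word (w ++ w') = (b.word w').trans (b.word w) := by
  induction w with
  | nil => exact ((b.word w').trans_refl).symm
  | cons l w ih =>
    rw [List.cons_append, word, ih, OpenPartialHomeomorph.trans_assoc]
    rfl

theorem word_singleton (l : F.Slice × Bool) : b.word [l] = b.letter l :=
  (b.letter l).refl_trans

theorem word_inv (w : F.Word) : b.word (Word.inv w) = (b.word w).symm := by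
  induction w with
  | nil => rfl
  | cons l w ih =>
    have : Word.inv (l :: w) = Word.inv w ++ [(l.1, !l.2)] := by
      rw [Word.inv, List.map_cons, List.reverse_cons]
      rfl
    rw [this, word_append, ih, word_singleton, word,
      OpenPartialHomeomorph.trans_symm_eq_symm_trans_symm]
    congr 1
    obtain ⟨V, _ | _⟩ := l
    · exact (b.slice V).symm_symm.symm
    · rfl

theorem word_append_apply (w w' : F.Word) (y : Y) :
    b.word (w ++ w') y = b.word w (b.word w' y) := by
  rw [word_append]; rfl

theorem mem_word_append_source {w w' : F.Word} {y : Y} : y ∈ (b.word (w ++ w')).source ↔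
    y ∈ (b.word w').source ∧ b.word w' y ∈ (b.word w).source := by
  rw [word_append, OpenPartialHomeomorph.trans_source]; rfl

/-- The pairs of a word and a point in its domain. -/
abbrev WordDom : Type u := {p : F.Word × Y // p.2 ∈ (b.word p.1).source}

theorem isOpen_wordDom : IsOpen {p : F.Word × Y | p.2 ∈ (b.word p.1).source} := by
  rw [isOpen_iff_mem_nhds]
  rintro ⟨w, y⟩ hy
  refine mem_of_superset (prod_mem_nhds (mem_nhds_discrete.2 (mem_singleton w))
    ((b.word w).open_source.mem_nhds hy)) ?_
  rintro ⟨w', y'⟩ ⟨h, hy'⟩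
  obtain rfl : w' = w := h
  exact hy'

theorem continuous_word : Continuous fun p : b.WordDom => b.word p.1.1 p.1.2 := by
  refine continuous_iff_continuousAt.2 fun p => ?_
  have h₁ : ContinuousAt (fun q : b.WordDom => b.word p.1.1 q.1.2) p :=
    ContinuousAt.comp (g := b.word p.1.1) ((b.word p.1.1).continuousAt p.2)
      (continuous_snd.comp continuous_subtype_val).continuousAt
  have h₂ : ∀ᶠ q : b.WordDom in 𝓝 p, q.1.1 = p.1.1 :=
    (continuous_fst.comp continuous_subtype_val).continuousAt.eventually
      (mem_nhds_discrete.2 (mem_singleton p.1.1))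
  refine h₁.congr ?_
  filter_upwards [h₂] with q hq
  rw [hq]

variable {b} {Z : Type u} [TopologicalSpace Z] {c : F.Action Z} {φ : C(Y, Z)}

theorem IsEquivariant.letter_eq (h : b.IsEquivariant c φ) (l : F.Slice × Bool) (y : Y) :
    φ (b.letter l y) = c.letter l (φ y) := by
  obtain ⟨V, _ | _⟩ := l
  · exact h.slice_symm_eq V y
  · exact h.slice_eq V y

theorem IsEquivariant.mem_letter_source (h : b.IsEquivariant c φ) {l : F.Slice × Bool} {y : Y} :
    φ y ∈ (c.letter l).source ↔ y ∈ (b.letter l).source := by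
  obtain ⟨V, _ | _⟩ := l
  · exact h.mem_slice_target
  · exact h.mem_slice_source

theorem IsEquivariant.word_eq (h : b.IsEquivariant c φ) (w : F.Word) (y : Y) :
    φ (b.word w y) = c.word w (φ y) := by
  induction w with
  | nil => rfl
  | cons l w ih =>
    change φ (b.letter l (b.word w y)) = c.letter l (c.word w (φ y))
    rw [h.letter_eq, ih]

theorem IsEquivariant.mem_word_source (h : b.IsEquivariant c φ) {w : F.Word} {y : Y} :
    φ y ∈ (c.word w).source ↔ y ∈ (b.word w).source := by
  induction w with
  | nil => exact Iff.rfl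
  | cons l w ih =>
    simp only [word, OpenPartialHomeomorph.trans_source, mem_inter_iff, mem_preimage, ih,
      ← h.word_eq, h.mem_letter_source]

end Word

/-! ### The groupoid of germs -/

section Germs

variable {Ω : Type u} [TopologicalSpace Ω] (a : F.Action Ω)

/-- Two words have the same germ at `ω` if they act in the same way on all points of all actions
over some neighbourhood of `ω`. -/
def GermEq (w w' : F.Word) (ω : Ω) : Prop :=
  ∀ᶠ ω₁ in 𝓝 ω, ∀ (Y : Type u) [TopologicalSpace Y] (b : F.Action Y) (φ : C(Y, Ω)),
    b.IsEquivariant a φ → ∀ y, φ y = ω₁ → b.word w y = b.word w' y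

variable {a} in
theorem GermEq.apply_eq {w w' : F.Word} {ω : Ω} (h : a.GermEq w w' ω) {Y : Type u}
    [TopologicalSpace Y] {b : F.Action Y} {φ : C(Y, Ω)} (hφ : b.IsEquivariant a φ) {y : Y}
    (hy : φ y = ω) : b.word w y = b.word w' y :=
  h.self_of_nhds Y b φ hφ y hy

theorem germEq_refl (w : F.Word) (ω : Ω) : a.GermEq w w ω :=
  Eventually.of_forall fun _ _ _ _ _ _ _ _ => rfl

variable {a} in
theorem GermEq.symm {w w' : F.Word} {ω : Ω} (h : a.GermEq w w' ω) : a.GermEq w' w ω :=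
  h.mono fun _ h Y _ b φ hφ y hy => (h Y b φ hφ y hy).symm

variable {a} in
theorem GermEq.trans {w w' w'' : F.Word} {ω : Ω} (h : a.GermEq w w' ω) (h' : a.GermEq w' w'' ω) :
    a.GermEq w w'' ω := by
  filter_upwards [h, h'] with ω₁ h h' Y _ b φ hφ y hy
  exact (h Y b φ hφ y hy).trans (h' Y b φ hφ y hy)

variable {a} in
-- The outer words are compared near the moved point `a.word w ω`; continuity of `w` at `ω` pulls
-- that neighbourhood back.
theorem GermEq.append {w₁ w₂ w w' : F.Word} {ω : Ω} (hω : ω ∈ (a.word w).source)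
    (h : a.GermEq w₁ w₂ (a.word w ω)) (h' : a.GermEq w w' ω) :
    a.GermEq (w₁ ++ w) (w₂ ++ w') ω := by
  filter_upwards [h', ((a.word w).continuousAt hω).eventually h] with ω₁ h' h Y _ b φ hφ y hy
  rw [word_append_apply, word_append_apply, ← h' Y b φ hφ y hy]
  exact h Y b φ hφ _ (by rw [hφ.word_eq, hy])

variable {a} in
theorem GermEq.inv {w w' : F.Word} {ω : Ω} (hω : ω ∈ (a.word w).source)
    (hω' : ω ∈ (a.word w').source) (h : a.GermEq w w' ω) :
    a.GermEq w.inv w'.inv (a.word w ω) := by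
  have hc : Tendsto (a.word w).symm (𝓝 (a.word w ω)) (𝓝 ω) := (a.word w).tendsto_symm hω
  filter_upwards [(a.word w).open_target.mem_nhds ((a.word w).map_source hω), hc.eventually h,
    hc.eventually ((a.word w').open_source.mem_nhds hω')] with ω₁ h₁ h₂ h₃ Y _ b φ hφ y hy
  have hy₁ : y ∈ (b.word w).target := by
    have : y ∈ (b.word w.inv).source := by
      rw [← hφ.mem_word_source, hy, word_inv]
      exact h₁
    rwa [word_inv] at this
  have hy₂ : φ ((b.word w).symm y) = (a.word w).symm ω₁ := by
    rw [← word_inv, hφ.word_eq, word_inv, hy]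
  have hy₃ : (b.word w).symm y ∈ (b.word w').source := by
    rw [← hφ.mem_word_source, hy₂]
    exact h₃
  rw [word_inv, word_inv]
  have := h₂ Y b φ hφ _ hy₂
  rw [(b.word w).right_inv hy₁] at this
  rw [← (b.word w').left_inv hy₃, ← this]

theorem germEq_mul_inv {w : F.Word} {ω : Ω} (hω : ω ∈ (a.word w).source) :
    a.GermEq (w ++ w.inv) [] (a.word w ω) := by
  filter_upwards [(a.word w).open_target.mem_nhds ((a.word w).map_source hω)]
    with ω₁ h₁ Y _ b φ hφ y hy
  have hy₁ : y ∈ (b.word w.inv).source := by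
    rw [← hφ.mem_word_source, hy, word_inv]
    exact h₁
  rw [word_inv] at hy₁
  rw [word_append_apply, word_inv]
  exact (b.word w).right_inv hy₁

theorem germEq_inv_mul {w : F.Word} {ω : Ω} (hω : ω ∈ (a.word w).source) :
    a.GermEq (w.inv ++ w) [] ω := by
  filter_upwards [(a.word w).open_source.mem_nhds hω] with ω₁ h₁ Y _ b φ hφ y hy
  rw [word_append_apply, word_inv]
  exact (b.word w).left_inv (hφ.mem_word_source.1 (hy ▸ h₁))

/-- Equality of germs. -/
def germSetoid : Setoid a.WordDom where
  r p q := p.1.2 = q.1.2 ∧ a.GermEq p.1.1 q.1.1 p.1.2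
  iseqv :=
    { refl := fun _ => ⟨rfl, a.germEq_refl _ _⟩
      symm := fun h => ⟨h.1.symm, h.1 ▸ h.2.symm⟩
      trans := fun h h' => ⟨h.1.trans h'.1, h.2.trans (h.1 ▸ h'.2)⟩ }

/-- The space of germs of words. -/
def Germs : Type u := Quotient a.germSetoid

instance : TopologicalSpace a.Germs := inferInstanceAs (TopologicalSpace (Quotient a.germSetoid))

variable {a}

/-- The germ of a word at a point. -/
def germ (p : a.WordDom) : a.Germs := Quotient.mk _ p

theorem germ_eq_iff {p q : a.WordDom} :
    germ p = germ q ↔ p.1.2 = q.1.2 ∧ a.GermEq p.1.1 q.1.1 p.1.2 :=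
  Quotient.eq (r := a.germSetoid)

theorem germ_surjective : Function.Surjective (germ : a.WordDom → a.Germs) := Quotient.mk_surjective

/-- Words with equal germs at a point have equal germs at all nearby points, so the saturation of an
open set is open. -/
theorem isOpenQuotientMap_germ : IsOpenQuotientMap (germ : a.WordDom → a.Germs) := by
  refine ⟨germ_surjective, continuous_quotient_mk', fun O hO => ?_⟩
  refine (isQuotientMap_quotient_mk' (s := a.germSetoid)).isOpen_preimage.1 ?_
  change IsOpen ((germ : a.WordDom → a.Germs) ⁻¹' (germ '' O))
  rw [isOpen_iff_mem_nhds]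
  rintro ⟨⟨w', ω⟩, hw'⟩ ⟨⟨⟨w, ω'⟩, hw⟩, hmem, h⟩
  obtain ⟨h₁, h₂⟩ := germ_eq_iff.1 h
  simp only at h₁ h₂ hw hw'
  subst h₁
  obtain ⟨W, hW, rfl⟩ := isOpen_induced_iff.1 hO
  have hc : Continuous fun q : a.WordDom => q.1.2 := continuous_snd.comp continuous_subtype_val
  have hc' : Continuous fun q : a.WordDom => q.1.1 := continuous_fst.comp continuous_subtype_val
  have hp : Tendsto (fun q : a.WordDom => q.1.2) (𝓝 ⟨(w', ω'), hw'⟩) (𝓝 ω') := hc.tendsto _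
  have hp' : Tendsto (fun q : a.WordDom => q.1.1) (𝓝 ⟨(w', ω'), hw'⟩) (𝓝 w') := hc'.tendsto _
  have e₁ := hp'.eventually ((isOpen_discrete {w'}).mem_nhds rfl)
  have e₂ := hp.eventually (eventually_eventually_nhds.2 h₂)
  have e₃ := hp.eventually ((a.word w).open_source.mem_nhds hw)
  have e₄ : ∀ᶠ q : a.WordDom in 𝓝 ⟨(w', ω'), hw'⟩, (w, q.1.2) ∈ W :=
    (tendsto_const_nhds.prodMk_nhds hp).eventually (hW.mem_nhds hmem)
  filter_upwards [e₁, e₂, e₃, e₄] with q h₁ h₂ h₃ h₄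
  exact ⟨⟨(w, q.1.2), h₃⟩, h₄, germ_eq_iff.2 ⟨rfl, by rw [show q.1.1 = w' from h₁]; exact h₂⟩⟩

/-! ### The étale groupoid structure on germs. -/

namespace Germs

/-- The source of a germ. -/
def s : a.Germs → Ω := Quotient.lift (fun p => p.1.2) fun _ _ h => h.1

/-- The range of a germ. -/
noncomputable def r : a.Germs → Ω := Quotient.lift (fun p => a.word p.1.1 p.1.2) fun _ q h =>
  (h.2.apply_eq (IsEquivariant.refl a) rfl).trans (congrArg (a.word q.1.1) h.1)

theorem s_germ (p : a.WordDom) : s (germ p) = p.1.2 := rfl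

/-- The unit germ at a point. -/
def unit (ω : Ω) : a.Germs := germ ⟨([], ω), mem_univ ω⟩

theorem word_inv_mem_source {w : F.Word} {ω : Ω} (h : ω ∈ (a.word w).source) :
    a.word w ω ∈ (a.word w.inv).source := by
  rw [word_inv]
  exact (a.word w).map_source h

theorem word_inv_apply {w : F.Word} {ω : Ω} (h : ω ∈ (a.word w).source) :
    a.word w.inv (a.word w ω) = ω := by
  rw [word_inv]
  exact (a.word w).left_inv h

/-- The inverse of a germ. -/
noncomputable def inv : a.Germs → a.Germs :=
  Quotient.lift (fun p => germ ⟨(p.1.1.inv, a.word p.1.1 p.1.2), word_inv_mem_source p.2⟩)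
    (by
      rintro ⟨⟨w, ω⟩, hw⟩ ⟨⟨w', ω'⟩, hw'⟩ ⟨h₁, h₂⟩
      simp only at h₁ h₂ hw hw'
      subst h₁
      exact germ_eq_iff.2 ⟨h₂.apply_eq (IsEquivariant.refl a) rfl, h₂.inv hw hw'⟩)

theorem inv_germ (p : a.WordDom) :
    inv (germ p) = germ ⟨(p.1.1.inv, a.word p.1.1 p.1.2), word_inv_mem_source p.2⟩ := rfl

/-- Only composable germs multiply, so instead of lifting a function of two variables, one germ is
shown to serve all pairs of representatives with matching base points. -/
theorem exists_mul (g h : a.Germs) (e : s g = r h) : ∃ k : a.Germs,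
    ∀ (w w' : F.Word) (ω : Ω) (hw : a.word w' ω ∈ (a.word w).source) (hw' : ω ∈ (a.word w').source),
      g = germ ⟨(w, a.word w' ω), hw⟩ → h = germ ⟨(w', ω), hw'⟩ →
        k = germ ⟨(w ++ w', ω), a.mem_word_append_source.2 ⟨hw', hw⟩⟩ := by
  obtain ⟨⟨⟨w, ω'⟩, hw⟩, rfl⟩ := germ_surjective g
  obtain ⟨⟨⟨w', ω⟩, hw'⟩, rfl⟩ := germ_surjective h
  obtain rfl : ω' = a.word w' ω := e
  refine ⟨germ ⟨(w ++ w', ω), a.mem_word_append_source.2 ⟨hw', hw⟩⟩, ?_⟩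
  intro w₁ w₁' ω₁ hw₁ hw₁' h₁ h₂
  obtain ⟨-, h₁⟩ := germ_eq_iff.1 h₁
  obtain ⟨rfl, h₂⟩ := germ_eq_iff.1 h₂
  exact germ_eq_iff.2 ⟨rfl, h₁.append hw' h₂⟩

/-- The product of germs. -/
noncomputable def mul (g h : a.Germs) (e : s g = r h) : a.Germs := (exists_mul g h e).choose

theorem mul_germ (w w' : F.Word) (ω : Ω) (hw : a.word w' ω ∈ (a.word w).source)
    (hw' : ω ∈ (a.word w').source)
    (e : s (germ ⟨(w, a.word w' ω), hw⟩ : a.Germs) = r (germ ⟨(w', ω), hw'⟩ : a.Germs)) :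
    mul (germ ⟨(w, a.word w' ω), hw⟩) (germ ⟨(w', ω), hw'⟩) e =
      germ ⟨(w ++ w', ω), a.mem_word_append_source.2 ⟨hw', hw⟩⟩ :=
  (exists_mul _ _ e).choose_spec w w' ω hw hw' rfl rfl

theorem mul_germ' (p q : a.WordDom) (e : p.1.2 = a.word q.1.1 q.1.2) :
    mul (germ p) (germ q) e =
      germ ⟨(p.1.1 ++ q.1.1, q.1.2), a.mem_word_append_source.2 ⟨q.2, e ▸ p.2⟩⟩ := by
  obtain ⟨⟨w, ω'⟩, hw⟩ := p
  obtain ⟨⟨w', ω⟩, hw'⟩ := q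
  simp only at e hw hw'
  subst e
  exact mul_germ w w' ω hw hw' rfl

theorem continuous_s : Continuous (s : a.Germs → Ω) :=
  isOpenQuotientMap_germ.continuous_comp_iff.1 (continuous_snd.comp continuous_subtype_val)

theorem isOpenMap_s : IsOpenMap (s : a.Germs → Ω) :=
  isOpenQuotientMap_germ.isOpenMap_iff.2
    (isOpenMap_snd.comp a.isOpen_wordDom.isOpenMap_subtype_val)

/-- Words are discrete, so the germs of one fixed word form an open set, and on it the base point
determines the germ. -/
theorem isLocalHomeomorph_s : IsLocalHomeomorph (s : a.Germs → Ω) := by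
  rw [isLocalHomeomorph_iff_isOpenEmbedding_restrict]
  intro g
  obtain ⟨p, rfl⟩ := germ_surjective g
  have hU : IsOpen (germ '' {q : a.WordDom | q.1.1 = p.1.1}) :=
    isOpenQuotientMap_germ.isOpenMap _ ((isOpen_discrete {p.1.1}).preimage
      (continuous_fst.comp continuous_subtype_val))
  refine ⟨_, hU.mem_nhds ⟨p, rfl, rfl⟩, ?_⟩
  refine .of_continuous_injective_isOpenMap (continuous_s.comp continuous_subtype_val) ?_
    (isOpenMap_s.comp hU.isOpenMap_subtype_val)
  rintro ⟨_, q, hq, rfl⟩ ⟨_, q', hq', rfl⟩ h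
  have h' : q.1.2 = q'.1.2 := h
  have : q = q' := Subtype.ext (Prod.ext (hq.trans (Eq.symm hq')) h')
  subst this
  rfl

theorem continuous_inv : Continuous (inv : a.Germs → a.Germs) := by
  refine isOpenQuotientMap_germ.continuous_comp_iff.1
    ((isOpenQuotientMap_germ (a := a)).continuous.comp ?_)
  exact (((continuous_of_discreteTopology (f := fun w : F.Word => w.inv)).comp
    (continuous_fst.comp continuous_subtype_val)).prodMk a.continuous_word).subtype_mk _

theorem continuous_mul :
    Continuous fun p : {p : a.Germs × a.Germs // s p.1 = r p.2} => mul p.1.1 p.1.2 p.2 := by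
  refine continuous_of_isOpenQuotientMap_restrict
    ((isOpenQuotientMap_germ (a := a)).prodMap (isOpenQuotientMap_germ (a := a)))
    {p | s p.1 = r p.2} ?_
  have : ∀ p : Prod.map germ germ ⁻¹' {p : a.Germs × a.Germs | s p.1 = r p.2},
      p.1.1.1.2 = a.word p.1.2.1.1 p.1.2.1.2 := fun p => p.2
  refine Continuous.congr (f := fun p : Prod.map germ germ ⁻¹'
    {p : a.Germs × a.Germs | s p.1 = r p.2} => germ ⟨(p.1.1.1.1 ++ p.1.2.1.1, p.1.2.1.2),
    a.mem_word_append_source.2 ⟨p.1.2.2, this p ▸ p.1.1.2⟩⟩) ?_ fun p => (mul_germ' _ _ p.2).symm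
  refine isOpenQuotientMap_germ.continuous.comp (Continuous.subtype_mk (Continuous.prodMk ?_ ?_) _)
  · exact (continuous_of_discreteTopology (f := fun q : F.Word × F.Word => q.1 ++ q.2)).comp
      (((continuous_fst.comp continuous_subtype_val).comp
        (continuous_fst.comp continuous_subtype_val)).prodMk
        ((continuous_fst.comp continuous_subtype_val).comp
          (continuous_snd.comp continuous_subtype_val)))
  · exact (continuous_snd.comp continuous_subtype_val).comp
      (continuous_snd.comp continuous_subtype_val)

theorem inv_inv (g : a.Germs) : inv (inv g) = g := by
  obtain ⟨⟨⟨w, ω⟩, hw⟩, rfl⟩ := germ_surjective g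
  rw [inv_germ, inv_germ]
  refine germ_eq_iff.2 ⟨word_inv_apply hw, ?_⟩
  refine Eventually.of_forall fun _ Y _ b _ _ y _ => ?_
  change b.word w.inv.inv y = b.word w y
  rw [word_inv, word_inv, OpenPartialHomeomorph.symm_symm]

theorem s_inv (g : a.Germs) : s (inv g) = r g := by
  obtain ⟨p, rfl⟩ := germ_surjective g
  rfl

end Germs

variable (a)

/-- The étale groupoid of germs of an action. -/
noncomputable abbrev germGroupoid : EtaleGroupoid.{u} where
  Obj := Ω
  Arr := a.Germs
  r := Germs.r
  s := Germs.s
  unit := Germs.unit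
  inv := Germs.inv
  mul := Germs.mul
  r_mul g h e := by
    obtain ⟨p, rfl⟩ := germ_surjective g
    obtain ⟨q, rfl⟩ := germ_surjective h
    rw [Germs.mul_germ' p q e]
    exact (a.word_append_apply _ _ _).trans (congrArg (a.word p.1.1) (Eq.symm e))
  s_mul g h e := by
    obtain ⟨p, rfl⟩ := germ_surjective g
    obtain ⟨q, rfl⟩ := germ_surjective h
    rw [Germs.mul_germ' p q e, Germs.s_germ, Germs.s_germ]
  mul_assoc g h k e e' := by
    obtain ⟨⟨⟨w₁, ω₁⟩, hw₁⟩, rfl⟩ := germ_surjective g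
    obtain ⟨⟨⟨w₂, ω₂⟩, hw₂⟩, rfl⟩ := germ_surjective h
    obtain ⟨⟨⟨w₃, ω₃⟩, hw₃⟩, rfl⟩ := germ_surjective k
    obtain rfl : ω₂ = a.word w₃ ω₃ := e'
    obtain rfl : ω₁ = a.word w₂ (a.word w₃ ω₃) := e
    simp only [Germs.mul_germ']
    refine (Germs.mul_germ' ⟨(w₁ ++ w₂, a.word w₃ ω₃), _⟩ ⟨(w₃, ω₃), hw₃⟩ rfl).trans (Eq.trans ?_
      (Germs.mul_germ' ⟨(w₁, _), hw₁⟩ ⟨(w₂ ++ w₃, ω₃), _⟩ (a.word_append_apply _ _ _).symm).symm)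
    refine germ_eq_iff.2 ⟨rfl, ?_⟩
    simp only [List.append_assoc]
    exact a.germEq_refl _ _
  r_unit _ := rfl
  s_unit _ := rfl
  unit_mul g := by
    obtain ⟨p, rfl⟩ := germ_surjective g
    exact Germs.mul_germ' ⟨([], a.word p.1.1 p.1.2), mem_univ _⟩ p rfl
  mul_unit g := by
    obtain ⟨p, rfl⟩ := germ_surjective g
    refine (Germs.mul_germ' p ⟨([], p.1.2), mem_univ _⟩ rfl).trans (germ_eq_iff.2 ⟨rfl, ?_⟩)
    simp only [List.append_nil]
    exact a.germEq_refl _ _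
  r_inv g := by
    obtain ⟨p, rfl⟩ := germ_surjective g
    exact Germs.word_inv_apply p.2
  s_inv := Germs.s_inv
  mul_inv g := by
    obtain ⟨p, rfl⟩ := germ_surjective g
    refine (Germs.mul_germ' p ⟨(p.1.1.inv, a.word p.1.1 p.1.2), Germs.word_inv_mem_source p.2⟩
      (Germs.word_inv_apply p.2).symm).trans (germ_eq_iff.2 ⟨rfl, ?_⟩)
    exact a.germEq_mul_inv p.2
  inv_mul g := by
    obtain ⟨p, rfl⟩ := germ_surjective g
    refine (Germs.mul_germ' ⟨(p.1.1.inv, a.word p.1.1 p.1.2), Germs.word_inv_mem_source p.2⟩ p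
      rfl).trans (germ_eq_iff.2 ⟨rfl, ?_⟩)
    exact a.germEq_inv_mul p.2
  continuous_unit := isOpenQuotientMap_germ.continuous.comp
    ((continuous_const.prodMk continuous_id).subtype_mk _)
  continuous_inv := Germs.continuous_inv
  continuous_mul := Germs.continuous_mul
  isLocalHomeomorph_r := by
    have h : (Germs.r : a.Germs → Ω) = Germs.s ∘ Germs.inv := funext fun g => (Germs.s_inv g).symm
    rw [h]
    let i : a.Germs ≃ₜ a.Germs :=
      { toFun := Germs.inv
        invFun := Germs.inv
        left_inv := Germs.inv_inv
        right_inv := Germs.inv_inv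
        continuous_toFun := Germs.continuous_inv
        continuous_invFun := Germs.continuous_inv }
    exact Germs.isLocalHomeomorph_s.comp i.isLocalHomeomorph
  isLocalHomeomorph_s := Germs.isLocalHomeomorph_s

end Germs

end Action

end Diagram

end GroupoidDiagrams

namespace GroupoidDiagrams

open Set Filter Topology

namespace Diagram

variable {C : Type u} [SmallCategory C] {F : Diagram C}

/-- A slice through a given point. -/
@[reducible]
noncomputable def sliceAt {x y : C} (g : x ⟶ y) (γ : (F.X g).carrier) : F.Slice :=
  ⟨g, (exists_slice g γ isOpen_univ (mem_univ γ)).choose,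
    (exists_slice g γ isOpen_univ (mem_univ γ)).choose_spec.1,
    (exists_slice g γ isOpen_univ (mem_univ γ)).choose_spec.2.2.2.1,
    (exists_slice g γ isOpen_univ (mem_univ γ)).choose_spec.2.2.2.2⟩

theorem mem_sliceAt {x y : C} (g : x ⟶ y) (γ : (F.X g).carrier) : γ ∈ (sliceAt g γ).carrier :=
  (exists_slice g γ isOpen_univ (mem_univ γ)).choose_spec.2.2.1

namespace Action

/-! ### Germs defined by elements of the correspondences. -/

section Arr

variable {Ω : Type u} [TopologicalSpace Ω] (a : F.Action Ω)

theorem letter_act {Y : Type u} [TopologicalSpace Y] (b : F.Action Y) (V : F.Slice)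
    {γ : (F.X V.hom).carrier} (hγ : γ ∈ V.carrier) (y : b.part V.src)
    (e : (F.X V.hom).s γ = b.anchor _ y) : b.word [(V, true)] y = b.act V.hom γ y e :=
  b.slice_apply V hγ y e

theorem mem_letter_source (V : F.Slice) {γ : (F.X V.hom).carrier} (hγ : γ ∈ V.carrier)
    (ω : a.part V.src) (e : (F.X V.hom).s γ = a.anchor _ ω) :
    (ω : Ω) ∈ (a.word [(V, true)]).source := by
  rw [word_singleton]
  exact a.mem_slice_source_of_eq V hγ ω e

/-- The germ at `ω` of the action of slices through `γ`. -/
noncomputable def arr {x x' : C} (g : x ⟶ x') (γ : (F.X g).carrier) (ω : a.part x)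
    (e : (F.X g).s γ = a.anchor x ω) : a.Germs :=
  germ ⟨([(sliceAt g γ, true)], ω), a.mem_letter_source (sliceAt g γ) (mem_sliceAt g γ) ω e⟩

/-- Since `s` is open, points near `ω` have anchors in the image of `V ∩ V'`; there both slices act
through a common element. -/
theorem germEq_of_mem {x x' : C} (g : x ⟶ x') {V V' : Set (F.X g).carrier} (hV : IsOpen V)
    (hV' : IsOpen V') (hs : InjOn (F.X g).s V) (hs' : InjOn (F.X g).s V')
    (hq : InjOn (F.X g).right.orbitMk V) (hq' : InjOn (F.X g).right.orbitMk V')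
    {γ : (F.X g).carrier} (hγ : γ ∈ V) (hγ' : γ ∈ V') (ω : a.part x)
    (e : (F.X g).s γ = a.anchor x ω) :
    a.GermEq [(⟨g, V, hV, hs, hq⟩, true)] [(⟨g, V', hV', hs', hq'⟩, true)] ω := by
  have ho := a.isOpen_subtype ((isOpenMap_s g _ (hV.inter hV')).preimage (a.continuous_anchor x))
  filter_upwards [ho.mem_nhds ⟨ω.2, γ, ⟨hγ, hγ'⟩, e⟩]
  rintro _ ⟨hω, γ₁, ⟨h₁, h₂⟩, e₁⟩ Y _ b φ hφ y rfl
  have hy : y ∈ b.part x := hφ.mem_part.1 hω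
  have e₂ : (F.X g).s γ₁ = b.anchor x ⟨y, hy⟩ := e₁.trans (hφ.anchor_eq hy)
  rw [b.letter_act ⟨g, V, hV, hs, hq⟩ h₁ ⟨y, hy⟩ e₂,
    b.letter_act ⟨g, V', hV', hs', hq'⟩ h₂ ⟨y, hy⟩ e₂]

theorem arr_eq (V : F.Slice) {γ : (F.X V.hom).carrier} (hγ : γ ∈ V.carrier) (ω : a.part V.src)
    (e : (F.X V.hom).s γ = a.anchor _ ω) :
    a.arr V.hom γ ω e = germ (a := a) ⟨([(V, true)], ω), a.mem_letter_source V hγ ω e⟩ := by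
  obtain ⟨g, V, hV, hs, hq⟩ := V
  have h := a.germEq_of_mem g (sliceAt g γ).isOpen hV (sliceAt g γ).injOn_s hs
    (sliceAt g γ).injOn_orbitMk hq (mem_sliceAt g γ) hγ ω e
  exact germ_eq_iff.2 ⟨rfl, h⟩

theorem arr_congr {x x' : C} (g : x ⟶ x') {γ γ' : (F.X g).carrier} {ω ω' : a.part x}
    (hγ : γ = γ') (hω : ω = ω') (e : (F.X g).s γ = a.anchor x ω)
    (e' : (F.X g).s γ' = a.anchor x ω') : a.arr g γ ω e = a.arr g γ' ω' e' := by
  subst hγ hω; rfl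

theorem r_arr {x x' : C} (g : x ⟶ x') (γ : (F.X g).carrier) (ω : a.part x)
    (e : (F.X g).s γ = a.anchor x ω) : (a.arr g γ ω e).r = a.act g γ ω e :=
  a.letter_act (sliceAt g γ) (mem_sliceAt g γ) ω e

/-- Composable pairs near `(γ₁, γ₂)` have sources filling a neighbourhood of `s γ₂`, and continuity
of `μ` keeps their products in the slice chosen at `γ₁ · γ₂`. So all three slices act compatibly
near `ω`. -/
theorem arr_mul_arr {x x' x'' : C} (g₁ : x' ⟶ x'') (g₂ : x ⟶ x') (k : x ⟶ x'') (hk : g₂ ≫ g₁ = k)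
    (γ₁ : (F.X g₁).carrier) (γ₂ : (F.X g₂).carrier) (ω : a.part x)
    (e₁ : (F.X g₁).s γ₁ = (F.X g₂).r γ₂) (e₂ : (F.X g₂).s γ₂ = a.anchor x ω)
    (d : (F.X g₁).s γ₁ = a.anchor x' (a.act g₂ γ₂ ω e₂))
    (d' : (a.arr g₁ γ₁ (a.act g₂ γ₂ ω e₂) d).s = (a.arr g₂ γ₂ ω e₂).r) :
    (a.arr g₁ γ₁ (a.act g₂ γ₂ ω e₂) d).mul (a.arr g₂ γ₂ ω e₂) d' =
      a.arr k (F.mul g₁ g₂ k hk γ₁ γ₂ e₁) ω ((s_mul g₁ g₂ k hk γ₁ γ₂ e₁).trans e₂) := by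
  refine (Germs.mul_germ' _ _ d').trans (germ_eq_iff.2 ⟨rfl, ?_⟩)
  change a.GermEq ([(sliceAt g₁ γ₁, true)] ++ [(sliceAt g₂ γ₂, true)])
    [(sliceAt k (F.mul g₁ g₂ k hk γ₁ γ₂ e₁), true)] ω
  let T := (F.X g₁).FibreProd (F.X g₂)
  have ho : IsOpenMap fun p : T => (F.X g₂).s p.1.2 :=
    (isOpenMap_s g₂).comp (isOpenMap_fibreProd_snd (isOpenMap_s g₁) (F.X g₂).left.continuous_anchor)
  have hN : IsOpen {p : T | p.1.1 ∈ (sliceAt g₁ γ₁).carrier ∧ p.1.2 ∈ (sliceAt g₂ γ₂).carrier ∧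
      F.mul g₁ g₂ k hk p.1.1 p.1.2 p.2 ∈ (sliceAt k (F.mul g₁ g₂ k hk γ₁ γ₂ e₁)).carrier} :=
    ((sliceAt g₁ γ₁).isOpen.preimage (continuous_fst.comp continuous_subtype_val)).inter
      (((sliceAt g₂ γ₂).isOpen.preimage (continuous_snd.comp continuous_subtype_val)).inter
        ((sliceAt k (F.mul g₁ g₂ k hk γ₁ γ₂ e₁)).isOpen.preimage (continuous_mul g₁ g₂ k hk)))
  have hO := a.isOpen_subtype ((ho _ hN).preimage (a.continuous_anchor x))
  filter_upwards [hO.mem_nhds ⟨ω.2, ⟨(γ₁, γ₂), e₁⟩, ⟨mem_sliceAt _ _, mem_sliceAt _ _,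
    mem_sliceAt _ _⟩, e₂⟩]
  rintro _ ⟨hω, ⟨⟨γ₁', γ₂'⟩, e₁'⟩, ⟨h₁, h₂, h₃⟩, e₂'⟩ Y _ b φ hφ y rfl
  simp only at h₁ h₂ h₃ e₁' e₂'
  have hy : y ∈ b.part x := hφ.mem_part.1 hω
  have e₃ : (F.X g₂).s γ₂' = b.anchor x ⟨y, hy⟩ := e₂'.trans (hφ.anchor_eq hy)
  rw [b.word_append_apply, b.letter_act (sliceAt g₂ γ₂) h₂ ⟨y, hy⟩ e₃,
    b.letter_act (sliceAt g₁ γ₁) h₁ _ (e₁'.trans (b.anchor_act _ _ _ _).symm),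
    b.act_act' g₁ g₂ k hk γ₁' γ₂' ⟨y, hy⟩ e₁' e₃,
    b.letter_act (sliceAt k (F.mul g₁ g₂ k hk γ₁ γ₂ e₁)) h₃ ⟨y, hy⟩]

theorem continuous_arr {x x' : C} (g : x ⟶ x') :
    Continuous fun p : {p : (F.X g).carrier × a.part x // (F.X g).s p.1 = a.anchor x p.2} =>
      a.arr g p.1.1 p.1.2 p.2 := by
  refine continuous_iff_continuousAt.2 fun p => ?_
  have hN : IsOpen {q : {p : (F.X g).carrier × a.part x // (F.X g).s p.1 = a.anchor x p.2} |
      q.1.1 ∈ (sliceAt g p.1.1).carrier} :=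
    (sliceAt g p.1.1).isOpen.preimage (continuous_fst.comp continuous_subtype_val)
  refine ContinuousOn.continuousAt ?_ (hN.mem_nhds (mem_sliceAt g p.1.1))
  rw [continuousOn_iff_continuous_domRestrict]
  refine Continuous.congr (f := fun q => germ ⟨([(sliceAt g p.1.1, true)], q.1.1.2),
    a.mem_letter_source (sliceAt g p.1.1) q.2 q.1.1.2 q.1.2⟩) ?_
    fun q => (a.arr_eq (sliceAt g p.1.1) q.2 q.1.1.2 q.1.2).symm
  refine isOpenQuotientMap_germ.continuous.comp (Continuous.subtype_mk
    (continuous_const.prodMk ?_) _)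
  exact continuous_subtype_val.comp (continuous_snd.comp
    (continuous_subtype_val.comp continuous_subtype_val))

/-- Followed by the local homeomorphism `s`, this is the projection to `ω`, which is open. -/
theorem isOpenMap_arr {x x' : C} (g : x ⟶ x') :
    IsOpenMap fun p : {p : (F.X g).carrier × a.part x // (F.X g).s p.1 = a.anchor x p.2} =>
      a.arr g p.1.1 p.1.2 p.2 :=
  Germs.isLocalHomeomorph_s.isOpenMap_of_comp (a.continuous_arr g)
    ((a.isClopen_part x).isOpen.isOpenMap_subtype_val.comp
      (isOpenMap_fibreProd_snd (isOpenMap_s g) (a.continuous_anchor x)))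

theorem germ_cons (l : F.Slice × Bool) (w : F.Word) (ω : Ω) (h : ω ∈ (a.word (l :: w)).source) :
    ∃ (h₁ : a.word w ω ∈ (a.word [l]).source) (h₂ : ω ∈ (a.word w).source),
      (germ ⟨(l :: w, ω), h⟩ : a.Germs) =
        Germs.mul (germ ⟨([l], a.word w ω), h₁⟩) (germ ⟨(w, ω), h₂⟩) rfl := by
  have h' := (a.mem_word_append_source (w := [l]) (w' := w)).1 h
  exact ⟨h'.2, h'.1, (Germs.mul_germ [l] w ω h'.2 h'.1 rfl).symm⟩

variable {a} in
/-- The germs are generated by the germs of slices. -/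
theorem germs_induction {P : a.Germs → Prop} (unit : ∀ ω, P (Germs.unit ω))
    (mul : ∀ g h e, P g → P h → P (Germs.mul g h e)) (inv : ∀ g, P g → P g.inv)
    (arr : ∀ {x x' : C} (g : x ⟶ x') (γ : (F.X g).carrier) (ω : a.part x)
      (e : (F.X g).s γ = a.anchor x ω), P (a.arr g γ ω e)) (u : a.Germs) : P u := by
  have hpos : ∀ (V : F.Slice) (ω : Ω) (h : ω ∈ (a.word [(V, true)]).source),
      P (germ ⟨([(V, true)], ω), h⟩) := by
    intro V ω h
    have h' := h
    rw [word_singleton] at h'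
    obtain ⟨hω, γ, hγ, e⟩ := a.mem_slice_source.1 h'
    have := arr V.hom γ ⟨ω, hω⟩ e
    rwa [a.arr_eq V hγ ⟨ω, hω⟩ e] at this
  obtain ⟨⟨⟨w, ω⟩, h⟩, rfl⟩ := germ_surjective u
  simp only at h
  induction w generalizing ω with
  | nil => exact unit ω
  | cons l w ih =>
    obtain ⟨h₁, h₂, e⟩ := a.germ_cons l w ω h
    rw [e]
    refine mul _ _ _ ?_ (ih ω h₂)
    obtain ⟨V, _ | _⟩ := l
    · have h₃ : a.word w ω ∈ (a.word [(V, true)]).target := by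
        have : (a.word (Word.inv [(V, true)])) = a.word [(V, false)] := rfl
        rw [word_inv] at this
        rw [← this] at h₁
        exact h₁
      have h₄ := (a.word [(V, true)]).map_target h₃
      have := inv _ (hpos V _ h₄)
      rw [Germs.inv_germ] at this
      have h₅ := (a.word [(V, true)]).right_inv h₃
      refine Eq.subst (motive := P) (germ_eq_iff.2 ⟨h₅, ?_⟩) this
      exact a.germEq_refl _ _
    · exact hpos V _ h₁

end Arr

/-! ### Actions of the groupoid of germs -/

section Model

variable {Ω : Type u} [TopologicalSpace Ω] {a : F.Action Ω}

/-- The canonical map to a universal action. -/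
noncomputable def IsUniversal.lift (hu : a.IsUniversal) {Y : Type u} [TopologicalSpace Y]
    (b : F.Action Y) : C(Y, Ω) := (hu Y b).choose

theorem IsUniversal.isEquivariant_lift (hu : a.IsUniversal) {Y : Type u} [TopologicalSpace Y]
    (b : F.Action Y) : b.IsEquivariant a (hu.lift b) := (hu Y b).choose_spec.1

theorem IsUniversal.eq_of_isEquivariant (hu : a.IsUniversal) {Y : Type u} [TopologicalSpace Y]
    {b : F.Action Y} {φ ψ : C(Y, Ω)} (hφ : b.IsEquivariant a φ) (hψ : b.IsEquivariant a ψ) :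
    φ = ψ := (hu Y b).unique hφ hψ

/-! ### From actions of the diagram to actions of the germ groupoid. -/

section ToLeftAction

variable (hu : a.IsUniversal) {Y : Type u} [TopologicalSpace Y] (b : F.Action Y)

/-- Well defined because equality of germs was imposed on every action over `Ω`, in particular on
`Y` with its canonical map. -/
theorem exists_germ_smul (u : a.Germs) (y : Y) (e : u.s = hu.lift b y) :
    ∃ z : Y, ∀ p : a.WordDom, germ p = u → b.word p.1.1 y = z := by
  obtain ⟨p, rfl⟩ := germ_surjective u
  refine ⟨b.word p.1.1 y, fun q h => ?_⟩
  obtain ⟨h₁, h₂⟩ := germ_eq_iff.1 h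
  exact h₂.apply_eq (hu.isEquivariant_lift b) (h₁.trans e).symm

/-- The action of germs of words. -/
noncomputable def germSmul (u : a.Germs) (y : Y) (e : u.s = hu.lift b y) : Y :=
  (exists_germ_smul hu b u y e).choose

theorem germSmul_germ (p : a.WordDom) (y : Y) (e : (germ p).s = hu.lift b y) :
    germSmul hu b (germ p) y e = b.word p.1.1 y :=
  ((exists_germ_smul hu b (germ p) y e).choose_spec p rfl).symm

/-- The action of the groupoid of germs of the universal action on any action. -/
noncomputable def toLeftAction : LeftAction a.germGroupoid Y where
  anchor := hu.lift b
  smul := germSmul hu b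
  continuous_anchor := (hu.lift b).continuous
  continuous_smul := by
    refine continuous_of_isOpenQuotientMap_restrict
      ((isOpenQuotientMap_germ (a := a)).prodMap (IsOpenQuotientMap.id (X := Y)))
      {p | Germs.s p.1 = hu.lift b p.2} ?_
    refine Continuous.congr (f := fun p => b.word p.1.1.1.1 p.1.2) ?_
      fun p => (germSmul_germ hu b p.1.1 p.1.2 p.2).symm
    have h : ∀ p : Prod.map (germ : a.WordDom → a.Germs) id ⁻¹'
        {p : a.Germs × Y | Germs.s p.1 = hu.lift b p.2},
        p.1.2 ∈ (b.word p.1.1.1.1).source := fun p => by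
      rw [← (hu.isEquivariant_lift b).mem_word_source]
      have h₁ : p.1.1.1.2 = hu.lift b p.1.2 := p.2
      rw [← h₁]
      exact p.1.1.2
    exact b.continuous_word.comp ((((continuous_fst.comp continuous_subtype_val).comp
      (continuous_fst.comp continuous_subtype_val)).prodMk
      (continuous_snd.comp continuous_subtype_val)).subtype_mk h)
  anchor_smul u y e := by
    obtain ⟨p, rfl⟩ := germ_surjective u
    rw [germSmul_germ, (hu.isEquivariant_lift b).word_eq]
    exact congrArg (a.word p.1.1) (Eq.symm e)
  mul_smul u v y e e' := by
    obtain ⟨p, rfl⟩ := germ_surjective u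
    obtain ⟨q, rfl⟩ := germ_surjective v
    have h : ∀ (u u' : a.Germs) (_ : u = u') (d : u.s = hu.lift b y) (d' : u'.s = hu.lift b y),
        germSmul hu b u y d = germSmul hu b u' y d' := by
      rintro u _ rfl _ _
      rfl
    refine (h _ _ (Germs.mul_germ' p q e) _ e').trans ?_
    refine (germSmul_germ hu b ⟨(p.1.1 ++ q.1.1, q.1.2), _⟩ y e').trans ?_
    simp only [germSmul_germ]
    exact b.word_append_apply _ _ _
  unit_smul y := germSmul_germ hu b _ y rfl

theorem toLeftAction_smul_germ (p : a.WordDom) (y : Y) (e : (germ p).s = hu.lift b y) :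
    (toLeftAction hu b).smul (germ p) y e = b.word p.1.1 y := germSmul_germ hu b p y e

end ToLeftAction

/-! ### From actions of the germ groupoid to actions of the diagram. -/

section OfLeftAction

variable {Y : Type u} [TopologicalSpace Y] (l : LeftAction a.germGroupoid Y)

/-- The anchor map restricted to a part. -/
def anchorPart (x : C) (y : l.anchor ⁻¹' a.part x) : a.part x := ⟨l.anchor y, y.2⟩

theorem continuous_anchorPart (x : C) : Continuous (anchorPart l x) :=
  (l.continuous_anchor.comp continuous_subtype_val).subtype_mk _

theorem anchor_smul_arr {x x' : C} (g : x ⟶ x') (γ : (F.X g).carrier)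
    (y : l.anchor ⁻¹' a.part x) (e : (F.X g).s γ = a.anchor x (anchorPart l x y)) :
    l.anchor (l.smul (a.arr g γ (anchorPart l x y) e) y rfl) =
      (a.act g γ (anchorPart l x y) e : Ω) :=
  (l.anchor_smul (a.arr g γ (anchorPart l x y) e) y rfl).trans (a.r_arr g γ _ e)

/-- The action of a correspondence induced by an action of the groupoid of germs. -/
noncomputable def arrSmul {x x' : C} (g : x ⟶ x') (γ : (F.X g).carrier)
    (y : l.anchor ⁻¹' a.part x) (e : (F.X g).s γ = a.anchor x (anchorPart l x y)) :
    l.anchor ⁻¹' a.part x' :=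
  ⟨l.smul (a.arr g γ (anchorPart l x y) e) y rfl, by
    change l.anchor _ ∈ a.part x'
    rw [anchor_smul_arr]
    exact (a.act g γ _ e).2⟩

theorem anchorPart_arrSmul {x x' : C} (g : x ⟶ x') (γ : (F.X g).carrier)
    (y : l.anchor ⁻¹' a.part x) (e : (F.X g).s γ = a.anchor x (anchorPart l x y)) :
    anchorPart l x' (arrSmul l g γ y e) = a.act g γ (anchorPart l x y) e :=
  Subtype.ext (anchor_smul_arr l g γ y e)

theorem continuous_arrSmul {x x' : C} (g : x ⟶ x') :
    Continuous fun p : {p : (F.X g).carrier × l.anchor ⁻¹' a.part x //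
      (F.X g).s p.1 = a.anchor x (anchorPart l x p.2)} => arrSmul l g p.1.1 p.1.2 p.2 := by
  refine Continuous.subtype_mk (l.continuous_smul.comp (Continuous.subtype_mk (Continuous.prodMk
    ((a.continuous_arr g).comp (Continuous.subtype_mk (f := fun p : {p : (F.X g).carrier ×
      l.anchor ⁻¹' a.part x // (F.X g).s p.1 = a.anchor x (anchorPart l x p.2)} =>
        (p.1.1, anchorPart l x p.1.2)) ?_ fun p => p.2)) ?_) fun p => rfl)) _
  · exact (continuous_fst.comp continuous_subtype_val).prodMk
      ((continuous_anchorPart l x).comp (continuous_snd.comp continuous_subtype_val))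
  · exact continuous_subtype_val.comp (continuous_snd.comp continuous_subtype_val)

theorem isOpenMap_arrSmul {x x' : C} (g : x ⟶ x') :
    IsOpenMap fun p : {p : (F.X g).carrier × l.anchor ⁻¹' a.part x //
      (F.X g).s p.1 = a.anchor x (anchorPart l x p.2)} => arrSmul l g p.1.1 p.1.2 p.2 := by
  let D := {p : (F.X g).carrier × a.part x // (F.X g).s p.1 = a.anchor x p.2}
  let S : Set (a.Germs × Y) := {p | p.1.s = l.anchor p.2}
  let f : D × Y → a.Germs × Y := Prod.map (fun p : D => a.arr g p.1.1 p.1.2 p.2) id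
  have hf : IsOpenMap (S.restrictPreimage f) :=
    ((a.isOpenMap_arr g).prodMap IsOpenMap.id).restrictPreimage S
  have hl : IsOpenMap fun p : S => l.smul p.1.1 p.1.2 p.2 := l.isOpenMap_smul
  -- Adding the redundant point `ω` under `y` factors the action map through `a.arr` and the
  -- groupoid action, both of which are open.
  let i : {p : (F.X g).carrier × l.anchor ⁻¹' a.part x //
      (F.X g).s p.1 = a.anchor x (anchorPart l x p.2)} ≃ₜ f ⁻¹' S :=
    { toFun := fun p => ⟨(⟨(p.1.1, anchorPart l x p.1.2), p.2⟩, p.1.2), rfl⟩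
      invFun := fun q => ⟨(q.1.1.1.1, ⟨q.1.2, by
          have h : (q.1.1.1.2 : Ω) = l.anchor q.1.2 := q.2
          change l.anchor q.1.2 ∈ a.part x
          rw [← h]
          exact q.1.1.1.2.2⟩),
        q.1.1.2.trans (congrArg (a.anchor x) (Subtype.ext q.2))⟩
      left_inv := fun p => rfl
      right_inv := fun q => by
        refine Subtype.ext (Prod.ext (Subtype.ext (Prod.ext rfl (Subtype.ext ?_))) rfl)
        exact Eq.symm q.2
      continuous_toFun := by
        refine Continuous.subtype_mk (Continuous.prodMk (Continuous.subtype_mk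
          ((continuous_fst.comp continuous_subtype_val).prodMk ((continuous_anchorPart l x).comp
            (continuous_snd.comp continuous_subtype_val))) _) ?_) _
        exact continuous_subtype_val.comp (continuous_snd.comp continuous_subtype_val)
      continuous_invFun := by
        refine Continuous.subtype_mk (Continuous.prodMk ?_ (Continuous.subtype_mk ?_ _)) _
        · exact continuous_fst.comp (continuous_subtype_val.comp
            (continuous_fst.comp continuous_subtype_val))
        · exact continuous_snd.comp continuous_subtype_val }
  have ho : IsOpen (l.anchor ⁻¹' a.part x') := (a.isClopen_part x').isOpen.preimage
    l.continuous_anchor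
  refine ho.isOpenEmbedding_subtypeVal.isOpenMap_iff.2 ?_
  exact (hl.comp hf).comp i.isOpenMap

theorem arrSmul_congr {x x' : C} (g : x ⟶ x') {γ γ' : (F.X g).carrier}
    {y y' : l.anchor ⁻¹' a.part x} (hγ : γ = γ') (hy : y = y')
    (e : (F.X g).s γ = a.anchor x (anchorPart l x y))
    (e' : (F.X g).s γ' = a.anchor x (anchorPart l x y')) :
    arrSmul l g γ y e = arrSmul l g γ' y' e' := by
  subst hγ hy; rfl

theorem arrSmul_arrSmul {x x' x'' : C} (g₁ : x' ⟶ x'') (g₂ : x ⟶ x') (k : x ⟶ x'')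
    (hk : g₂ ≫ g₁ = k) (γ₁ : (F.X g₁).carrier) (γ₂ : (F.X g₂).carrier)
    (y : l.anchor ⁻¹' a.part x) (e₁ : (F.X g₁).s γ₁ = (F.X g₂).r γ₂)
    (e₂ : (F.X g₂).s γ₂ = a.anchor x (anchorPart l x y))
    (d : (F.X g₁).s γ₁ = a.anchor x' (anchorPart l x' (arrSmul l g₂ γ₂ y e₂))) :
    arrSmul l g₁ γ₁ (arrSmul l g₂ γ₂ y e₂) d =
      arrSmul l k (F.mul g₁ g₂ k hk γ₁ γ₂ e₁) y ((s_mul g₁ g₂ k hk γ₁ γ₂ e₁).trans e₂) := by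
  refine Subtype.ext ?_
  have d₁ : (F.X g₁).s γ₁ = a.anchor x' (a.act g₂ γ₂ (anchorPart l x y) e₂) :=
    e₁.trans (a.anchor_act _ _ _ _).symm
  have d₂ : (a.arr g₁ γ₁ (a.act g₂ γ₂ (anchorPart l x y) e₂) d₁).s =
      (a.arr g₂ γ₂ (anchorPart l x y) e₂).r := (a.r_arr _ _ _ _).symm
  have h₁ := a.arr_mul_arr g₁ g₂ k hk γ₁ γ₂ (anchorPart l x y) e₁ e₂ d₁ d₂
  have h₂ := l.mul_smul (a.arr g₁ γ₁ (a.act g₂ γ₂ (anchorPart l x y) e₂) d₁)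
    (a.arr g₂ γ₂ (anchorPart l x y) e₂) y d₂ rfl
  refine Eq.trans ?_ (h₂.symm.trans (l.smul_congr h₁ rfl _ _))
  exact l.smul_congr (a.arr_congr g₁ rfl (anchorPart_arrSmul l g₂ γ₂ y e₂) _ _) rfl _ _

/-- The action of the diagram induced by an action of the groupoid of germs. -/
noncomputable def ofLeftAction : F.Action Y where
  part x := l.anchor ⁻¹' a.part x
  isClopen_part x := (a.isClopen_part x).preimage l.continuous_anchor
  existsUnique_part y := a.existsUnique_part (l.anchor y)
  anchor x y := a.anchor x (anchorPart l x y)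
  continuous_anchor x := (a.continuous_anchor x).comp (continuous_anchorPart l x)
  act := arrSmul l
  continuous_act := continuous_arrSmul l
  isOpenMap_act := isOpenMap_arrSmul l
  surjective_act {x x'} g := by
    intro y'
    obtain ⟨⟨⟨γ, ω⟩, e⟩, h⟩ := a.surjective_act g (anchorPart l x' y')
    simp only at e h
    have h₁ : (a.arr g γ ω e).r = l.anchor y' := (a.r_arr g γ ω e).trans (congrArg Subtype.val h)
    -- Divide below, in `Ω`, and lift the quotient: the inverse germ applied to `y'` gives the
    -- required preimage.
    have h₂ : a.germGroupoid.s (Germs.inv (a.arr g γ ω e)) = l.anchor y' :=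
      (Germs.s_inv _).trans h₁
    have h₃ : l.anchor (l.smul (Germs.inv (a.arr g γ ω e)) y' h₂) = (ω : Ω) :=
      (l.anchor_smul _ _ _).trans (a.germGroupoid.r_inv (a.arr g γ ω e))
    let y : l.anchor ⁻¹' a.part x := ⟨l.smul (Germs.inv (a.arr g γ ω e)) y' h₂, by
      change l.anchor _ ∈ a.part x
      rw [h₃]
      exact ω.2⟩
    have h₄ : anchorPart l x y = ω := Subtype.ext h₃
    refine ⟨⟨(γ, y), e.trans (congrArg (a.anchor x) h₄.symm)⟩, Subtype.ext ?_⟩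
    refine Eq.trans (l.smul_congr (a.arr_congr g rfl h₄ _ e) rfl _ h₃.symm) ?_
    exact l.smul_inv_smul (a.arr g γ ω e) y' h₂ _
  anchor_act {x x'} g γ y e := by
    rw [anchorPart_arrSmul, a.anchor_act]
  act_act g₁ g₂ γ₁ γ₂ y e₁ e₂ := arrSmul_arrSmul l g₁ g₂ _ rfl γ₁ γ₂ y e₁ e₂ _
  exists_of_act_eq {x x'} g γ γ' y y' e e' h := by
    have h' := congrArg (anchorPart l x') h
    rw [anchorPart_arrSmul, anchorPart_arrSmul] at h'
    obtain ⟨η, d, d', rfl, h₂⟩ := a.exists_of_act_eq g γ γ' _ _ e e' h'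
    refine ⟨η, d, d', rfl, ?_⟩
    have e₁ : (F.X (𝟙 x)).s ((F.ι x).toHomeomorph η) = a.anchor x (anchorPart l x y') :=
      ((F.ι x).s_apply η).trans d'
    -- The arrow `η` found in `Ω` makes `η · y'` and `y` lie over the same point. The same germ of
    -- `γ` therefore acts on both with equal results, and germs act injectively.
    have hy : anchorPart l x (arrSmul l (𝟙 x) ((F.ι x).toHomeomorph η) y' e₁) = anchorPart l x y :=
      (anchorPart_arrSmul l _ _ _ _).trans h₂.symm
    have e₂ : (F.X g).s γ =
        a.anchor x (anchorPart l x (arrSmul l (𝟙 x) ((F.ι x).toHomeomorph η) y' e₁)) :=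
      e.trans (congrArg (a.anchor x) hy.symm)
    have h₃ : arrSmul l g γ (arrSmul l (𝟙 x) ((F.ι x).toHomeomorph η) y' e₁) e₂ =
        arrSmul l g γ y e := by
      rw [h, arrSmul_arrSmul l g (𝟙 x) g (Category.id_comp g) γ _ y'
        (d.trans ((F.ι x).r_apply η).symm)]
      exact arrSmul_congr l g (F.μ_unit_right g γ η d) rfl _ _
    refine Subtype.ext (l.smul_injective (a.arr g γ (anchorPart l x y) e) rfl
      (congrArg Subtype.val hy.symm) ?_)
    refine (congrArg Subtype.val h₃.symm).trans ?_
    exact l.smul_congr (a.arr_congr g rfl hy _ _) rfl _ _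

theorem isEquivariant_anchor : (ofLeftAction l).IsEquivariant a ⟨l.anchor, l.continuous_anchor⟩ :=
  ⟨fun _ y => y.2, fun _ _ => rfl, fun g γ y e => anchor_smul_arr l g γ y e⟩

theorem ofLeftAction_toLeftAction (hu : a.IsUniversal) (b : F.Action Y) :
    ofLeftAction (toLeftAction hu b) = b := by
  have hφ := hu.isEquivariant_lift b
  have hp : ∀ {x : C} {y : Y}, y ∈ (ofLeftAction (toLeftAction hu b)).part x → y ∈ b.part x :=
    fun h => hφ.mem_part.1 h
  refine eq_of_isEquivariant_id ⟨fun x y => hp y.2, fun x y => (hφ.anchor_eq (hp y.2)).symm, ?_⟩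
  intro x x' g γ y e
  refine (toLeftAction_smul_germ hu b _ y rfl).trans ?_
  exact b.letter_act (sliceAt g γ) (mem_sliceAt g γ) ⟨y, hp y.2⟩ (e.trans (hφ.anchor_eq (hp y.2)))

variable {l} {Z : Type u} [TopologicalSpace Z] {m : LeftAction a.germGroupoid Z} {φ : C(Y, Z)}

theorem isEquivariant_ofLeftAction_iff (hu : a.IsUniversal) :
    l.IsEquivariant m φ ↔ (ofLeftAction l).IsEquivariant (ofLeftAction m) φ := by
  constructor
  · rintro ⟨h, hs⟩
    have hp : ∀ {x : C} (y : l.anchor ⁻¹' a.part x), φ y ∈ m.anchor ⁻¹' a.part x := fun {x} y => by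
      change m.anchor (φ y) ∈ a.part x
      rw [h]
      exact y.2
    have hp' : ∀ {x : C} (y : l.anchor ⁻¹' a.part x),
        anchorPart m x ⟨φ y, hp y⟩ = anchorPart l x y := fun y => Subtype.ext (h y)
    refine ⟨fun x y => hp y, fun x y => congrArg (a.anchor x) (hp' y), ?_⟩
    intro x x' g γ y e
    refine (hs _ _ _).trans ?_
    exact m.smul_congr (a.arr_congr g rfl (hp' y).symm _ _) rfl _ _
  · intro h
    -- Both `m.anchor ∘ φ` and `l.anchor` are `F`-equivariant maps to the universal action, so they
    -- coincide. After this it suffices to treat generating germs.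
    have hanchor : ∀ y, m.anchor (φ y) = l.anchor y := fun y =>
      congrArg (fun f : C(Y, Ω) => f y) (hu.eq_of_isEquivariant
        ((isEquivariant_anchor m).comp h) (isEquivariant_anchor l))
    refine ⟨hanchor, fun u => ?_⟩
    refine germs_induction (P := fun u : a.Germs => ∀ (y : Y) (e : u.s = l.anchor y),
      φ (l.smul u y e) = m.smul u (φ y) (e.trans (hanchor y).symm)) ?_ ?_ ?_ ?_ u
    · intro ω y e
      obtain rfl : ω = l.anchor y := e
      refine (congrArg φ (l.unit_smul y)).trans ((m.unit_smul (φ y)).symm.trans ?_)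
      exact m.smul_congr (congrArg Germs.unit (hanchor y)) rfl _ _
    · intro u v d hu' hv y e
      have e' : v.s = l.anchor y := (a.germGroupoid.s_mul u v d).symm.trans e
      refine (congrArg φ (l.mul_smul u v y d e')).trans ?_
      refine (hu' _ _).trans (Eq.trans ?_ (m.mul_smul u v (φ y) d (e'.trans (hanchor y).symm)).symm)
      exact m.smul_congr rfl (hv y e') _ _
    · intro u hu' y e
      -- For inverses, apply `u` to both sides and cancel.
      have e₁ : a.germGroupoid.s u = l.anchor (l.smul u.inv y e) :=
        ((l.anchor_smul u.inv y e).trans (a.germGroupoid.r_inv u)).symm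
      refine m.smul_injective u (e₁.trans (hanchor _).symm) ((a.germGroupoid.r_inv u).symm.trans
        (m.anchor_smul _ _ _).symm) ?_
      refine (hu' _ e₁).symm.trans ?_
      refine (congrArg φ (l.smul_inv_smul u y e e₁)).trans ?_
      exact (m.smul_inv_smul u (φ y) _ _).symm
    · rintro x x' g γ ω e y e'
      have hy : l.anchor y ∈ a.part x := by
        rw [← e']
        exact ω.2
      obtain rfl : ω = anchorPart l x ⟨y, hy⟩ := Subtype.ext e'
      refine (h.act_eq g γ ⟨y, hy⟩ e).trans ?_
      exact m.smul_congr (a.arr_congr g rfl (Subtype.ext (hanchor y)) _ _) rfl _ _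

end OfLeftAction

/-- The groupoid of germs of a universal action is a groupoid model. -/
theorem IsUniversal.isGroupoidModel (hu : a.IsUniversal) : F.IsGroupoidModel a.germGroupoid := by
  refine ⟨fun Y _ =>
    { toFun := ofLeftAction
      invFun := fun b => toLeftAction hu b
      left_inv := fun l => ?_
      right_inv := fun b => ofLeftAction_toLeftAction hu b },
    fun Y Z _ _ l m φ => isEquivariant_ofLeftAction_iff hu⟩
  -- The round trip is the identity as soon as the identity map is equivariant, and this can be
  -- tested on the induced `F`-actions, where the other inverse law applies.
  refine LeftAction.eq_of_isEquivariant_id ((isEquivariant_ofLeftAction_iff hu).2 ?_)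
  rw [ofLeftAction_toLeftAction]
  exact IsEquivariant.refl _

end Model

end Action

/-- A groupoid model acts universally on its object space. -/
theorem IsGroupoidModel.exists_isUniversal {U : EtaleGroupoid.{u}} (h : F.IsGroupoidModel U) :
    ∃ a : F.Action U.Obj, a.IsUniversal := by
  obtain ⟨E, hE⟩ := h
  refine ⟨E _ (LeftAction.onObj U), fun Y _ b => ?_⟩
  obtain ⟨l, rfl⟩ := (E Y).surjective b
  refine ⟨⟨l.anchor, l.continuous_anchor⟩, (hE _ _ _ _ _).1 (l.isEquivariant_onObj_iff.2
    fun _ => rfl), fun φ hφ => ContinuousMap.ext ?_⟩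
  exact l.isEquivariant_onObj_iff.1 ((hE _ _ _ _ _).2 hφ)

end Diagram

end GroupoidDiagrams

theorem mainTheorem6 {C : Type u} [SmallCategory C] [Finite C] (F : GroupoidDiagrams.Diagram C)
    (hproper : F.IsProper) (hlc : F.IsLocallyCompact)
    (hcompact : ∀ x : C, CompactSpace (F.G x).Obj) :
    (∃ (Ω : Type u) (_ : TopologicalSpace Ω) (a : F.Action Ω), a.IsUniversal) ∧
    (∀ (Ω : Type u) [TopologicalSpace Ω] (a : F.Action Ω), a.IsUniversal →
      CompactSpace Ω ∧ T2Space Ω) ∧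
    (∃ U : GroupoidDiagrams.EtaleGroupoid.{u}, F.IsGroupoidModel U) ∧
    (∀ U : GroupoidDiagrams.EtaleGroupoid.{u}, F.IsGroupoidModel U →
      U.IsLocallyCompact ∧ CompactSpace U.Obj) := by
  have := hcompact
  have : ∀ x, T2Space (F.G x).Obj := fun x => (hlc.1 x).1
  -- The orbit space is the preimage of the whole compact object space under a proper map.
  have : ∀ (x y : C) (g : x ⟶ y), CompactSpace (F.X g).right.OrbitSpace := fun x y g =>
    ⟨(hproper g).isCompact_preimage isCompact_univ⟩
  have : ∀ (x y : C) (g : x ⟶ y), T2Space (F.X g).right.OrbitSpace := fun x y g => (hlc.2 g).2.2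
  have hu : F.univAction.IsUniversal := GroupoidDiagrams.Diagram.isUniversal_univAction
  -- Finiteness of `C` enters here: a finite disjoint union of compact fibres is compact.
  have hΩ : ∀ (Ω : Type u) [TopologicalSpace Ω] (a : F.Action Ω), a.IsUniversal →
      CompactSpace Ω ∧ T2Space Ω := fun Ω _ a ha =>
    ⟨(hu.homeomorph ha).compactSpace, (hu.homeomorph ha).t2Space⟩
  refine ⟨⟨_, _, _, hu⟩, hΩ, ⟨_, hu.isGroupoidModel⟩, fun U hU => ?_⟩
  obtain ⟨a, ha⟩ := hU.exists_isUniversal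
  obtain ⟨_, _⟩ := hΩ _ a ha
  exact ⟨⟨inferInstance, inferInstance⟩, inferInstance⟩
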